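/- Let $\mathbb k=\mathbb R$ or $\mathbb C$. A \emph{Frobenius algebra} is a commutative associative unital algebra with a symmetric nondegenerate bilinear form $\langle\ ,\ \rangle$ such that $\langle x\cdot y,z\rangle=\langle x,y\cdot z\rangle$. A \emph{Frobenius manifold} of charge $d\in\mathbb k$ is a finite-dimensional manifold $M$ over $\mathbb k$ (smooth or analytic) with a Frobenius algebra structure $(\cdot,\langle\ ,\ \rangle,e)$ on the tangent spaces, depending smoothly (resp. analytically) on the point, and with a vector field $E$, such that (FM1) the metric $\langle\ ,\ \rangle$ is flat (not necessarily positive definite), and its Levi-Civita connection $\nabla$ satisfies $\nabla e=0$ (flatness of the unity); (FM2) with $c(x,y,z)=\langle x\cdot y,z\rangle$, the 4-tensor $(\nabla_w c)(x,y,z)$ is symmetric in $x,y,z,w$; (FM3) $E$ is an Euler vector field: $\nabla\nabla E=0$, and for all vector fields $x,y$ $$[E,x\cdot y]-[E,x]\cdot y-x\cdot[E,y]=x\cdot y,\qquad E\langle x,y\rangle-\langle[E,x],y\rangle-\langle x,[E,y]\rangle=(2-d)\langle x,y\rangle .$$ Let the \emph{intersection form} be the bilinear form $(\omega_1,\omega_2)=i_E(\omega_1\cdot\omega_2)$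 on $T_t^*M$, where the product of covectors is induced from that of vectors by the isomorphism $\langle\ ,\ \rangle:T_tM\to T_t^*M$, and let the \emph{discriminant} $\Sigma\subset M$ be the set of points at which the determinant of the intersection form vanishes. \textbf{Proposition (almost duality).} Let $M$ be a Frobenius manifold of charge $d$. Then $M\setminus\Sigma$ is open, and $E$ is invertible in the algebra $T_tM$ for every $t\in M\setminus\Sigma$, so that $u*v:=(u\cdot v)/E$ is defined there. On $M\setminus\Sigma$ let $(\ ,\ )$ also denote the metric on tangent vectors inverse to the intersection form. Then $(*,(\ ,\ ),E)$ is a Frobenius algebra structure on the tangent spaces of $M\setminus\Sigma$, with unity $E$, depending smoothly (resp. analytically) on the point, and, with $\nabla_*$ the Levi-Civita connection of $(\ ,\ )$: (1) the metric $(\ ,\ )$ is flat; (2) with $c_*(x,y,z)=(x*y,z)$, the 4-tensor $(\nabla_{*,w}c_*)(x,y,z)$ is symmetric in $x,y,z,w$; (3) $E$ is also an Euler vector field of the new structure: $\nabla_*\nabla_*E=0$, and for all vector fields $x,y$ $$[E,x*y]-[E,x]*y-x*[E,y]=0,\qquad E(x,y)-([E,x],y)-(x,[E,y])=(1-d)(x,y).$$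 Thus all the axioms of a Frobenius manifold hold except flatness of the unity, where in the Euler axiom the weights $1$ and $2-d$ of the multiplication and of the metric become $0$ and $1-d$. -/

import Mathlib

open scoped Manifold ContDiff

noncomputable section

namespace AlmostDuality

/-! ### Linear algebra: Frobenius algebras and the dual structure on one tangent space -/

section Algebra

variable {𝕜 : Type*} [Field 𝕜] {V : Type*} [AddCommGroup V] [Module 𝕜 V]

/-- A bilinear multiplication, a bilinear form and a distinguished vector on a vector space. -/
structure AlgebraData (𝕜 : Type*) (V : Type*) [Field 𝕜] [AddCommGroup V] [Module 𝕜 V] where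
  /-- the multiplication `x · y` -/
  mul : V →ₗ[𝕜] V →ₗ[𝕜] V
  /-- the bilinear form `⟨x, y⟩` -/
  form : LinearMap.BilinForm 𝕜 V
  /-- the (candidate for the) unity -/
  unit : V

/-- The data form a Frobenius algebra: a commutative associative algebra with unity, with a
symmetric nondegenerate invariant bilinear form. -/
structure AlgebraData.IsFrobeniusAlgebra (A : AlgebraData 𝕜 V) : Prop where
  mul_comm : ∀ x y, A.mul x y = A.mul y x
  mul_assoc : ∀ x y z, A.mul (A.mul x y) z = A.mul x (A.mul y z)
  unit_mul : ∀ x, A.mul A.unit x = x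
  form_symm : ∀ x y, A.form x y = A.form y x
  form_nondegenerate : A.form.Nondegenerate
  invariant : ∀ x y z, A.form (A.mul x y) z = A.form x (A.mul y z)

variable [FiniteDimensional 𝕜 V]

open Classical in
/-- The inverse of the isomorphism `V → V*`, `v ↦ B(v, ·)`, defined by a nondegenerate bilinear
form `B` (and `0` if `B` is degenerate). -/
def sharp (B : LinearMap.BilinForm 𝕜 V) : Module.Dual 𝕜 V →ₗ[𝕜] V :=
  if h : B.Nondegenerate then ((B.toDual h).symm : Module.Dual 𝕜 V →ₗ[𝕜] V) else 0

/-- The form on `V*` inverse to a nondegenerate form `B` on `V`: it is the transport of `B` by the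
isomorphism `V → V*`; its Gram matrix in the dual basis is the inverse of the Gram matrix
of `B` (for symmetric `B`). -/
def inverseForm (B : LinearMap.BilinForm 𝕜 V) : LinearMap.BilinForm 𝕜 (Module.Dual 𝕜 V) :=
  B.compl₁₂ (sharp B) (sharp B)

/-- The form on `V` inverse to a nondegenerate form `B` on `V*` (with `V** = V`). -/
def inverseFormOfDual (B : LinearMap.BilinForm 𝕜 (Module.Dual 𝕜 V)) : LinearMap.BilinForm 𝕜 V :=
  (inverseForm B).compl₁₂ (Module.Dual.eval 𝕜 V) (Module.Dual.eval 𝕜 V)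

/-- The product of covectors, induced from the product of vectors by the isomorphism
`⟨ , ⟩ : V → V*`. -/
def AlgebraData.cotangentMul (A : AlgebraData 𝕜 V) :
    Module.Dual 𝕜 V →ₗ[𝕜] Module.Dual 𝕜 V →ₗ[𝕜] Module.Dual 𝕜 V :=
  (A.mul.compl₁₂ (sharp A.form) (sharp A.form)).compr₂ A.form

/-- The intersection form `(ω₁, ω₂) = i_E (ω₁ · ω₂)` on `V*`. -/
def AlgebraData.intersectionForm (A : AlgebraData 𝕜 V) (E : V) :
    LinearMap.BilinForm 𝕜 (Module.Dual 𝕜 V) :=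
  A.cotangentMul.compr₂ (Module.Dual.eval 𝕜 V E)

/-- The determinant of the Gram matrix of a bilinear form, in a chosen basis. Its vanishing does
not depend on the basis. -/
def gramDet {W : Type*} [AddCommGroup W] [Module 𝕜 W] [FiniteDimensional 𝕜 W]
    (B : LinearMap.BilinForm 𝕜 W) : 𝕜 :=
  (LinearMap.BilinForm.toMatrix (Module.finBasis 𝕜 W) B).det

/-- The product `u * v = (u · v) / E`, where `w / E` is the solution `z` of `E · z = w`
(when multiplication by `E` is invertible; the value is `0` otherwise). -/
def AlgebraData.starMul (A : AlgebraData 𝕜 V) (E : V) : V →ₗ[𝕜] V →ₗ[𝕜] V :=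
  A.mul.compr₂ (Ring.inverse (A.mul E : Module.End 𝕜 V))

/-- The dual data: the product `u * v = (u · v) / E`, the metric inverse to the intersection form,
and the unity `E`. -/
def AlgebraData.dual (A : AlgebraData 𝕜 V) (E : V) : AlgebraData 𝕜 V where
  mul := A.starMul E
  form := inverseFormOfDual (A.intersectionForm E)
  unit := E

end Algebra

/-! ### Vector fields and the axioms of a Frobenius manifold -/

section Manifold

variable {𝕜 : Type*} [RCLike 𝕜] {F : Type*} [NormedAddCommGroup F] [NormedSpace 𝕜 F]
  {M : Type*} [TopologicalSpace M] [ChartedSpace F M]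

instance [FiniteDimensional 𝕜 F] (x : M) : FiniteDimensional 𝕜 (TangentSpace 𝓘(𝕜, F) x) :=
  inferInstanceAs (FiniteDimensional 𝕜 F)

/-- A (not necessarily smooth) vector field on `M`. -/
abbrev VField (𝕜 : Type*) [RCLike 𝕜] (F : Type*) [NormedAddCommGroup F] [NormedSpace 𝕜 F]
    (M : Type*) [TopologicalSpace M] [ChartedSpace F M] : Type _ :=
  (x : M) → TangentSpace 𝓘(𝕜, F) x

/-- The vector field `X` is of class `C^n` at the point `x`. Identities at `x` between tensor
fields are tested below on the vector fields that are `C^n` at `x` only, so that locally defined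
vector fields (extended by zero) are included. -/
def VField.SmoothAt [IsManifold 𝓘(𝕜, F) 1 M] (n : ℕ∞ω) (X : VField 𝕜 F M) (x : M) : Prop :=
  ContMDiffAt 𝓘(𝕜, F) (𝓘(𝕜, F).prod 𝓘(𝕜, F)) n
    (fun p => (⟨p, X p⟩ : TangentBundle 𝓘(𝕜, F) M)) x

/-- The derivative `X f` of a function along a vector field. -/
def lieFun (X : VField 𝕜 F M) (f : M → 𝕜) (x : M) : 𝕜 := mvfderiv 𝓘(𝕜, F) f x (X x)

/-- The bracket `[X, Y]` of vector fields. -/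
def bracket (X Y : VField 𝕜 F M) : VField 𝕜 F M := VectorField.mlieBracket 𝓘(𝕜, F) X Y

/-- The type of connections `∇` on the tangent bundle; `∇ Y x v` stands for `(∇_v Y)(x)`. -/
abbrev Conn (𝕜 : Type*) [RCLike 𝕜] (F : Type*) [NormedAddCommGroup F] [NormedSpace 𝕜 F]
    (M : Type*) [TopologicalSpace M] [ChartedSpace F M] : Type _ :=
  VField 𝕜 F M → (x : M) → TangentSpace 𝓘(𝕜, F) x →L[𝕜] TangentSpace 𝓘(𝕜, F) x

/-- The vector field `∇_X Y`. -/
def Conn.cov (D : Conn 𝕜 F M) (X Y : VField 𝕜 F M) : VField 𝕜 F M := fun x => D Y x (X x)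

/-- The function `⟨X, Y⟩`. -/
def pairing (g : (x : M) → LinearMap.BilinForm 𝕜 (TangentSpace 𝓘(𝕜, F) x))
    (X Y : VField 𝕜 F M) : M → 𝕜 := fun x => g x (X x) (Y x)

/-- `D` is, over the open set `U`, the Levi-Civita connection of the metric `g`: the `C^n`
torsion-free connection compatible with `g`. -/
structure IsLeviCivitaOn [IsManifold 𝓘(𝕜, F) 1 M] (n : ℕ∞ω)
    (g : (x : M) → LinearMap.BilinForm 𝕜 (TangentSpace 𝓘(𝕜, F) x))
    (U : Set M) (D : Conn 𝕜 F M) : Prop where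
  isCovariantDerivative : IsCovariantDerivativeOn F D U
  smooth : ∀ x ∈ U, ∀ X Y : VField 𝕜 F M, X.SmoothAt n x → Y.SmoothAt n x →
    (D.cov X Y).SmoothAt n x
  torsion_free : ∀ x ∈ U, ∀ X Y : VField 𝕜 F M, X.SmoothAt n x → Y.SmoothAt n x →
    D.cov X Y x - D.cov Y X x = bracket X Y x
  metric : ∀ x ∈ U, ∀ X Y Z : VField 𝕜 F M, X.SmoothAt n x → Y.SmoothAt n x → Z.SmoothAt n x →
    lieFun X (pairing g Y Z) x = pairing g (D.cov X Y) Z x + pairing g Y (D.cov X Z) x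

/-- The curvature `R(X, Y) Z = ∇_X ∇_Y Z - ∇_Y ∇_X Z - ∇_[X, Y] Z`. -/
def Conn.curvature (D : Conn 𝕜 F M) (X Y Z : VField 𝕜 F M) : VField 𝕜 F M :=
  D.cov X (D.cov Y Z) - D.cov Y (D.cov X Z) - D.cov (bracket X Y) Z

/-- Multiplication, metric and unity on all tangent spaces of `M`. -/
abbrev AlgebraField (𝕜 : Type*) [RCLike 𝕜] (F : Type*) [NormedAddCommGroup F] [NormedSpace 𝕜 F]
    (M : Type*) [TopologicalSpace M] [ChartedSpace F M] : Type _ :=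
  (x : M) → AlgebraData 𝕜 (TangentSpace 𝓘(𝕜, F) x)

namespace AlgebraField

/-- The vector field `X · Y`. -/
def mul (A : AlgebraField 𝕜 F M) (X Y : VField 𝕜 F M) : VField 𝕜 F M := fun x => (A x).mul (X x) (Y x)

/-- The metric of the structure. -/
def metric (A : AlgebraField 𝕜 F M) (x : M) : LinearMap.BilinForm 𝕜 (TangentSpace 𝓘(𝕜, F) x) :=
  (A x).form

/-- The unity vector field of the structure. -/
def unit (A : AlgebraField 𝕜 F M) : VField 𝕜 F M := fun x => (A x).unit

/-- The function `c(X, Y, Z) = ⟨X · Y, Z⟩`. -/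
def c (A : AlgebraField 𝕜 F M) (X Y Z : VField 𝕜 F M) : M → 𝕜 := pairing A.metric (A.mul X Y) Z

/-- The function `(∇_W c)(X, Y, Z)`, where `(X, Y, Z, W) = (X 0, X 1, X 2, X 3)`. -/
def nablaC (A : AlgebraField 𝕜 F M) (D : Conn 𝕜 F M) (X : Fin 4 → VField 𝕜 F M) (x : M) : 𝕜 :=
  lieFun (X 3) (A.c (X 0) (X 1) (X 2)) x
    - A.c (D.cov (X 3) (X 0)) (X 1) (X 2) x
    - A.c (X 0) (D.cov (X 3) (X 1)) (X 2) x
    - A.c (X 0) (X 1) (D.cov (X 3) (X 2)) x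

/-- The Frobenius algebra structure depends `C^n`-smoothly on the point of the open set `U`: the
multiplication and the metric take smooth vector fields to smooth fields and functions, and the
unity is a smooth vector field. -/
structure SmoothOn [IsManifold 𝓘(𝕜, F) 1 M] (n : ℕ∞ω) (A : AlgebraField 𝕜 F M) (U : Set M) : Prop where
  mul : ∀ x ∈ U, ∀ X Y : VField 𝕜 F M, X.SmoothAt n x → Y.SmoothAt n x → (A.mul X Y).SmoothAt n x
  metric : ∀ x ∈ U, ∀ X Y : VField 𝕜 F M, X.SmoothAt n x → Y.SmoothAt n x →
    ContMDiffAt 𝓘(𝕜, F) 𝓘(𝕜, 𝕜) n (pairing A.metric X Y) x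
  unit : ∀ x ∈ U, A.unit.SmoothAt n x

/-- The axioms of a Frobenius structure on the open set `U` with metric connection `D` and Euler
vector field `E`, other than flatness of the unity. The constants `k` and `D₀` are the weights of
the multiplication and of the metric: `Lie_E (·) = k (·)` and `Lie_E ⟨ , ⟩ = D₀ ⟨ , ⟩`. -/
structure AxiomsExceptFlatUnity [IsManifold 𝓘(𝕜, F) 1 M] (n : ℕ∞ω) (A : AlgebraField 𝕜 F M)
    (E : VField 𝕜 F M) (k D₀ : 𝕜) (U : Set M) (D : Conn 𝕜 F M) : Prop where
  frobeniusAlgebra : ∀ x ∈ U, (A x).IsFrobeniusAlgebra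
  smooth : A.SmoothOn n U
  leviCivita : IsLeviCivitaOn n A.metric U D
  /-- the metric is flat -/
  flat : ∀ x ∈ U, ∀ X Y Z : VField 𝕜 F M, X.SmoothAt n x → Y.SmoothAt n x → Z.SmoothAt n x →
    D.curvature X Y Z x = 0
  /-- the 4-tensor `∇ c` is symmetric -/
  nablaC_symm : ∀ x ∈ U, ∀ X : Fin 4 → VField 𝕜 F M, (∀ i, (X i).SmoothAt n x) →
    ∀ σ : Equiv.Perm (Fin 4), A.nablaC D (X ∘ σ) x = A.nablaC D X x
  euler_smooth : ∀ x ∈ U, E.SmoothAt n x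
  /-- the Euler vector field is linear: `∇ ∇ E = 0` -/
  euler_linear : ∀ x ∈ U, ∀ X Y : VField 𝕜 F M, X.SmoothAt n x → Y.SmoothAt n x →
    D.cov X (D.cov Y E) x - D.cov (D.cov X Y) E x = 0
  euler_mul : ∀ x ∈ U, ∀ X Y : VField 𝕜 F M, X.SmoothAt n x → Y.SmoothAt n x →
    bracket E (A.mul X Y) x - A.mul (bracket E X) Y x - A.mul X (bracket E Y) x
      = k • A.mul X Y x
  euler_metric : ∀ x ∈ U, ∀ X Y : VField 𝕜 F M, X.SmoothAt n x → Y.SmoothAt n x →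
    lieFun E (pairing A.metric X Y) x - pairing A.metric (bracket E X) Y x
      - pairing A.metric X (bracket E Y) x = D₀ * pairing A.metric X Y x

/-- `A` and `E` form a Frobenius structure of charge `d` on the manifold `M`. -/
def IsFrobenius [IsManifold 𝓘(𝕜, F) 1 M] (n : ℕ∞ω) (A : AlgebraField 𝕜 F M)
    (E : VField 𝕜 F M) (d : 𝕜) : Prop :=
  ∃ D : Conn 𝕜 F M, A.AxiomsExceptFlatUnity n E 1 (2 - d) Set.univ D ∧
    ∀ x : M, ∀ X : VField 𝕜 F M, X.SmoothAt n x → D.cov X A.unit x = 0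

/-- The discriminant `Σ`: the points where the intersection form is degenerate. -/
def discriminant [FiniteDimensional 𝕜 F] (A : AlgebraField 𝕜 F M) (E : VField 𝕜 F M) : Set M :=
  {x | gramDet ((A x).intersectionForm (E x)) = 0}

/-- The dual multiplication, metric and unity: `u * v = (u · v) / E`, the metric given by the
intersection form, and the unity `E`. -/
def dual [FiniteDimensional 𝕜 F] (A : AlgebraField 𝕜 F M) (E : VField 𝕜 F M) : AlgebraField 𝕜 F M :=
  fun x => (A x).dual (E x)

end AlgebraField

end Manifold

end AlmostDuality

end

namespace AlmostDuality

open Bundle Filter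
open scoped Topology

/-! ### Frobenius algebras: division by `E` on one tangent space. -/

section Algebra

variable {𝕜 : Type*} [Field 𝕜] {V : Type*} [AddCommGroup V] [Module 𝕜 V]

/-! Under the isomorphism given by `⟨ , ⟩`, the intersection form becomes `(u, v) ↦ ⟨E·u, v⟩`. It is
therefore nondegenerate exactly where multiplication by `E` is invertible, and the inverse metric is
`(x, y) = ⟨x/E, y⟩`. Invertibility is an open condition and inversion is smooth, so `X/E` is a
smooth field wherever `X` is, off the discriminant. The Frobenius algebra axioms for the dual data
are then linear algebra.

For the differential axioms, put `S = c - ∇E` and define explicitly `∇_{*,v} Y = E·∇_v(Y/E) +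
v·S(Y/E)`. Symmetry of `∇c` together with the Euler axiom gives `∇_v(E·X)` (`cov_euler_mul`), hence
`∇_v X = ∇_{*,v} X + (1 - S)(v·(X/E))` (`cov_eq`). The correction is symmetric in `v` and `X`, so
`∇_*` is torsion-free for every `c`. It is metric when `S` has adjoint `1 - S`, that is, for `2c -
(2 - d) = 1`, or `c = (3 - d)/2`.

Flatness uses `∇S = 0`, which is `∇∇E = 0`. In `∇_{*,X}∇_{*,Y}Z` everything is then symmetric in
`X`, `Y` except terms whose antisymmetrization is controlled by flatness and torsion-freeness of `∇`
(`dualConn_dualConn`). Symmetry of `∇_* c_*` reduces to one transposition, which follows from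
symmetry of `∇c`, the derivative of associativity (`mulDeriv_mul`) and the Euler axiom. Finally `∇e
= 0` gives `∇_* E = (c - 1) id`, hence `∇_*∇_*E = 0`, and division by `E` lowers each Euler weight
by one. -/

theorem mul_inverse_apply {L : Module.End 𝕜 V} (hL : IsUnit L) (x : V) :
    L (Ring.inverse L x) = x :=
  congrArg (fun f : Module.End 𝕜 V => f x) (Ring.mul_inverse_cancel L hL)

theorem inverse_mul_apply {L : Module.End 𝕜 V} (hL : IsUnit L) (x : V) :
    Ring.inverse L (L x) = x :=
  congrArg (fun f : Module.End 𝕜 V => f x) (Ring.inverse_mul_cancel L hL)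

namespace AlgebraData.IsFrobeniusAlgebra

variable {A : AlgebraData 𝕜 V} {E : V}

theorem mul_left_comm (hA : A.IsFrobeniusAlgebra) (x y z : V) :
    A.mul x (A.mul y z) = A.mul y (A.mul x z) := by
  rw [← hA.mul_assoc, hA.mul_comm x y, hA.mul_assoc]

theorem form_mul_left (hA : A.IsFrobeniusAlgebra) (x y z : V) :
    A.form (A.mul x y) z = A.form y (A.mul x z) := by
  rw [hA.mul_comm, hA.invariant]

theorem eq_of_form_eq (hA : A.IsFrobeniusAlgebra) {x y : V}
    (h : ∀ z, A.form x z = A.form y z) : x = y :=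
  sub_eq_zero.1 (hA.form_nondegenerate.1 (x - y) fun z => by simp [h z])

/-- Division by `E` commutes with every multiplication, because the algebra is commutative and
associative. -/
theorem mul_inverse (hA : A.IsFrobeniusAlgebra) (hE : IsUnit (A.mul E : Module.End 𝕜 V))
    (x y : V) : A.mul x (Ring.inverse (A.mul E : Module.End 𝕜 V) y) =
      Ring.inverse (A.mul E : Module.End 𝕜 V) (A.mul x y) := by
  conv_rhs => rw [← mul_inverse_apply hE y, hA.mul_left_comm, inverse_mul_apply hE]

theorem form_inverse (hA : A.IsFrobeniusAlgebra) (hE : IsUnit (A.mul E : Module.End 𝕜 V))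
    (x y : V) : A.form x (Ring.inverse (A.mul E : Module.End 𝕜 V) y) =
      A.form (Ring.inverse (A.mul E : Module.End 𝕜 V) x) y := by
  conv_lhs => rw [← mul_inverse_apply hE x]
  rw [hA.form_mul_left, mul_inverse_apply hE]

variable [FiniteDimensional 𝕜 V]

theorem sharp_toDual (hA : A.IsFrobeniusAlgebra) (u : V) : sharp A.form (A.form u) = u := by
  have h : A.form.toDual hA.form_nondegenerate u = A.form u :=
    LinearMap.ext fun _ => LinearMap.BilinForm.toDual_def _
  rw [sharp, dif_pos hA.form_nondegenerate, ← h]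
  simp

theorem exists_form_eq (hA : A.IsFrobeniusAlgebra) (ξ : Module.Dual 𝕜 V) :
    ∃ u, A.form u = ξ :=
  ⟨(A.form.toDual hA.form_nondegenerate).symm ξ,
    LinearMap.ext (LinearMap.BilinForm.apply_toDual_symm_apply _)⟩

/-- Writing both covectors as metric duals of `u` and `v` turns `i_E(u·v)` into `⟨E·u, v⟩` by
invariance; all later facts about the intersection form come from this. -/
theorem intersectionForm_apply (hA : A.IsFrobeniusAlgebra) (E u : V) (ξ : Module.Dual 𝕜 V) :
    A.intersectionForm E (A.form u) ξ = ξ (A.mul E u) := by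
  obtain ⟨v, rfl⟩ := hA.exists_form_eq ξ
  have h : A.intersectionForm E (A.form u) (A.form v) =
      A.form (A.mul (sharp A.form (A.form u)) (sharp A.form (A.form v))) E := rfl
  rw [h, hA.sharp_toDual, hA.sharp_toDual, hA.mul_comm u v, hA.invariant, hA.mul_comm E]

theorem intersectionForm_nondegenerate_iff (hA : A.IsFrobeniusAlgebra) :
    (A.intersectionForm E).Nondegenerate ↔ IsUnit (A.mul E : Module.End 𝕜 V) := by
  have hsymm : ∀ ξ η, A.intersectionForm E ξ η = A.intersectionForm E η ξ := by
    intro ξ η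
    obtain ⟨u, rfl⟩ := hA.exists_form_eq ξ
    obtain ⟨v, rfl⟩ := hA.exists_form_eq η
    rw [hA.intersectionForm_apply, hA.intersectionForm_apply, hA.form_symm,
      hA.form_mul_left, hA.form_symm]
  rw [LinearMap.isUnit_iff_ker_eq_bot, LinearMap.ker_eq_bot']
  constructor
  · intro h u hu
    have h0 : A.form u = 0 := h.1 _ fun ξ => by
      rw [hA.intersectionForm_apply, hu, map_zero]
    exact hA.form_nondegenerate.1 u fun z => by rw [h0]; rfl
  · intro h
    have hl : (A.intersectionForm E).SeparatingLeft := by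
      intro ξ hξ
      obtain ⟨u, rfl⟩ := hA.exists_form_eq ξ
      rw [h u, map_zero]
      refine hA.form_nondegenerate.2 _ fun x => ?_
      rw [← hA.intersectionForm_apply, hξ]
    exact ⟨hl, fun ξ hξ => hl ξ fun η => by rw [hsymm, hξ]⟩

theorem gramDet_intersectionForm_ne_zero_iff (hA : A.IsFrobeniusAlgebra) :
    gramDet (A.intersectionForm E) ≠ 0 ↔ IsUnit (A.mul E : Module.End 𝕜 V) := by
  rw [← hA.intersectionForm_nondegenerate_iff, gramDet,
    ← LinearMap.BilinForm.nondegenerate_iff_det_ne_zero]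

theorem dual_form_apply (hA : A.IsFrobeniusAlgebra) (hE : IsUnit (A.mul E : Module.End 𝕜 V))
    (x y : V) : (A.dual E).form x y =
      A.form (Ring.inverse (A.mul E : Module.End 𝕜 V) x) y := by
  have hB := hA.intersectionForm_nondegenerate_iff.2 hE
  have key : ∀ z, sharp (A.intersectionForm E) (Module.Dual.eval 𝕜 V z) =
      A.form (Ring.inverse (A.mul E : Module.End 𝕜 V) z) := by
    intro z
    have h : (A.intersectionForm E).toDual hB
        (A.form (Ring.inverse (A.mul E : Module.End 𝕜 V) z)) = Module.Dual.eval 𝕜 V z := by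
      refine LinearMap.ext fun ξ => ?_
      rw [LinearMap.BilinForm.toDual_def, hA.intersectionForm_apply, mul_inverse_apply hE]
      rfl
    rw [sharp, dif_pos hB, ← h]
    simp
  have h : (A.dual E).form x y = A.intersectionForm E
      (sharp (A.intersectionForm E) (Module.Dual.eval 𝕜 V x))
      (sharp (A.intersectionForm E) (Module.Dual.eval 𝕜 V y)) := rfl
  rw [h, key, key, hA.intersectionForm_apply, mul_inverse_apply hE, hA.form_symm,
    hA.form_inverse hE]

theorem dual (hA : A.IsFrobeniusAlgebra) (hE : IsUnit (A.mul E : Module.End 𝕜 V)) :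
    (A.dual E).IsFrobeniusAlgebra := by
  have hm : ∀ x y, (A.dual E).mul x y =
      Ring.inverse (A.mul E : Module.End 𝕜 V) (A.mul x y) := fun _ _ => rfl
  have hsymm : ∀ x y, (A.dual E).form x y = (A.dual E).form y x := by
    intro x y
    rw [hA.dual_form_apply hE, hA.dual_form_apply hE, ← hA.form_inverse hE, hA.form_symm]
  have hl : (A.dual E).form.SeparatingLeft := by
    intro x hx
    have h0 := hA.form_nondegenerate.1 (Ring.inverse (A.mul E : Module.End 𝕜 V) x) fun y => by
      rw [← hA.dual_form_apply hE, hx]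
    rw [← mul_inverse_apply hE x, h0, map_zero]
  refine ⟨fun x y => by rw [hm, hm, hA.mul_comm], fun x y z => ?_, fun x => ?_, hsymm,
    ⟨hl, fun x hx => hl x fun y => by rw [hsymm, hx]⟩, fun x y z => ?_⟩
  · rw [hm, hm, hm, hm, hA.mul_inverse hE, hA.mul_comm _ z, hA.mul_inverse hE, hA.mul_comm z,
      hA.mul_assoc]
  · exact inverse_mul_apply hE x
  · rw [hA.dual_form_apply hE, hA.dual_form_apply hE, hm, hm, ← hA.form_inverse hE,
      ← hA.form_inverse hE, ← hA.form_inverse hE, hA.invariant, hA.mul_inverse hE,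
      hA.mul_inverse hE]

end AlgebraData.IsFrobeniusAlgebra

end Algebra

/-! ### Smoothness of vector fields and of the inverse of a field of endomorphisms. -/

noncomputable section Regularity

variable {𝕜 : Type*} [RCLike 𝕜] {F : Type*} [NormedAddCommGroup F] [NormedSpace 𝕜 F]
  {M : Type*} [TopologicalSpace M] [ChartedSpace F M]

/-- The tangent bundle is one class less regular than the manifold; for `n = ∞` or `ω` nothing is
lost. -/
theorem add_one_eq_self_of_infty_le {n : ℕ∞ω} (hn : ∞ ≤ n) : n + 1 = n := by
  match n, hn with
  | ⊤, _ => rfl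
  | ((⊤ : ℕ∞) : ℕ∞ω), _ => rfl
  | ((m : ℕ) : ℕ∞), h => exact absurd (WithTop.coe_le_coe.1 h) (by simp)

theorem isManifold_add_one {n : ℕ∞ω} (hn : ∞ ≤ n) [h : IsManifold 𝓘(𝕜, F) n M] :
    IsManifold 𝓘(𝕜, F) (n + 1) M := by
  rwa [add_one_eq_self_of_infty_le hn]

variable [IsManifold 𝓘(𝕜, F) 1 M] {n : ℕ∞ω} {x : M}

/-- The vector field with constant value `v` in the trivialization of the tangent bundle at `x`. -/
def constField (x : M) (v : F) : VField 𝕜 F M := fun p =>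
  (trivializationAt F (TangentSpace 𝓘(𝕜, F)) x).symmL 𝕜 p v

/-- The expression in the trivialization of the tangent bundle at `x` of a field of linear maps. -/
def inTriv [FiniteDimensional 𝕜 F] (L : (p : M) → Module.End 𝕜 (TangentSpace 𝓘(𝕜, F) p)) (x p : M) :
    F →L[𝕜] F :=
  LinearMap.toContinuousLinearMap <|
    ((trivializationAt F (TangentSpace 𝓘(𝕜, F)) x).continuousLinearMapAt 𝕜 p).toLinearMap ∘ₗ
      L p ∘ₗ ((trivializationAt F (TangentSpace 𝓘(𝕜, F)) x).symmL 𝕜 p).toLinearMap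

theorem eventually_mem_baseSet (x : M) :
    ∀ᶠ p in 𝓝 x, p ∈ (trivializationAt F (TangentSpace 𝓘(𝕜, F)) x).baseSet :=
  (trivializationAt F (TangentSpace 𝓘(𝕜, F)) x).open_baseSet.mem_nhds
    (mem_baseSet_trivializationAt F (TangentSpace 𝓘(𝕜, F)) x)

theorem VField.smoothAt_iff (hn : ∞ ≤ n) [IsManifold 𝓘(𝕜, F) n M] {X : VField 𝕜 F M} :
    X.SmoothAt n x ↔ ContMDiffAt 𝓘(𝕜, F) 𝓘(𝕜, F) n (fun p =>
      (trivializationAt F (TangentSpace 𝓘(𝕜, F)) x).continuousLinearMapAt 𝕜 p (X p)) x := by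
  have := isManifold_add_one (𝕜 := 𝕜) (F := F) (M := M) hn
  have : ContMDiffVectorBundle n F (TangentSpace 𝓘(𝕜, F) : M → Type _) 𝓘(𝕜, F) :=
    TangentBundle.contMDiffVectorBundle
  refine ((trivializationAt F (TangentSpace 𝓘(𝕜, F)) x).contMDiffAt_section_iff
    (mem_baseSet_trivializationAt F (TangentSpace 𝓘(𝕜, F)) x)).trans
    (EventuallyEq.contMDiffAt_iff ?_)
  filter_upwards [eventually_mem_baseSet (𝕜 := 𝕜) (F := F) x] with p hp
  rw [Trivialization.continuousLinearMapAt_apply_of_mem (R := 𝕜) _ hp]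

theorem VField.mdifferentiableAt_iff (hn : ∞ ≤ n) [IsManifold 𝓘(𝕜, F) n M] {X : VField 𝕜 F M} :
    MDifferentiableAt 𝓘(𝕜, F) (𝓘(𝕜, F).prod 𝓘(𝕜, F))
      (fun p => (⟨p, X p⟩ : TangentBundle 𝓘(𝕜, F) M)) x ↔
    MDifferentiableAt 𝓘(𝕜, F) 𝓘(𝕜, F) (fun p =>
      (trivializationAt F (TangentSpace 𝓘(𝕜, F)) x).continuousLinearMapAt 𝕜 p (X p)) x := by
  have : IsManifold 𝓘(𝕜, F) (1 + 1) M :=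
    .of_le (n := n) (le_trans (WithTop.coe_le_coe.2 le_top) hn)
  have : ContMDiffVectorBundle 1 F (TangentSpace 𝓘(𝕜, F) : M → Type _) 𝓘(𝕜, F) :=
    TangentBundle.contMDiffVectorBundle
  refine ((trivializationAt F (TangentSpace 𝓘(𝕜, F)) x).mdifferentiableAt_section_iff
    𝓘(𝕜, F) X (mem_baseSet_trivializationAt F (TangentSpace 𝓘(𝕜, F)) x)).trans
    (EventuallyEq.mdifferentiableAt_iff ?_)
  filter_upwards [eventually_mem_baseSet (𝕜 := 𝕜) (F := F) x] with p hp
  rw [Trivialization.continuousLinearMapAt_apply_of_mem (R := 𝕜) _ hp]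

theorem VField.SmoothAt.mdifferentiableAt (hn : ∞ ≤ n) {X : VField 𝕜 F M} (hX : X.SmoothAt n x) :
    MDifferentiableAt 𝓘(𝕜, F) (𝓘(𝕜, F).prod 𝓘(𝕜, F))
      (fun p => (⟨p, X p⟩ : TangentBundle 𝓘(𝕜, F) M)) x :=
  ContMDiffAt.mdifferentiableAt hX (by rintro rfl; simp at hn)

theorem VField.SmoothAt.congr {X Y : VField 𝕜 F M} (hX : X.SmoothAt n x)
    (h : ∀ᶠ p in 𝓝 x, Y p = X p) : Y.SmoothAt n x :=
  ContMDiffAt.congr_of_eventuallyEq hX (h.mono fun p hp => congrArg (TotalSpace.mk p) hp)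

theorem VField.SmoothAt.add (hn : ∞ ≤ n) [IsManifold 𝓘(𝕜, F) n M] {X Y : VField 𝕜 F M}
    (hX : X.SmoothAt n x) (hY : Y.SmoothAt n x) : VField.SmoothAt n (X + Y) x := by
  rw [smoothAt_iff hn] at *
  simpa using! ContMDiffAt.add hX hY

theorem VField.SmoothAt.sub (hn : ∞ ≤ n) [IsManifold 𝓘(𝕜, F) n M] {X Y : VField 𝕜 F M}
    (hX : X.SmoothAt n x) (hY : Y.SmoothAt n x) : VField.SmoothAt n (X - Y) x := by
  rw [smoothAt_iff hn] at *
  simpa using! ContMDiffAt.sub hX hY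

theorem VField.SmoothAt.const_smul (hn : ∞ ≤ n) [IsManifold 𝓘(𝕜, F) n M] {X : VField 𝕜 F M}
    (hX : X.SmoothAt n x) (c : 𝕜) : VField.SmoothAt n (c • X) x := by
  rw [smoothAt_iff hn] at *
  simpa using! ContMDiffAt.smul 
    (contMDiffAt_const (I := 𝓘(𝕜, F)) (I' := 𝓘(𝕜, 𝕜)) (c := c)) hX

theorem constField_smoothAt (hn : ∞ ≤ n) [IsManifold 𝓘(𝕜, F) n M] (v : F) :
    (constField (𝕜 := 𝕜) x v).SmoothAt n x := by
  rw [VField.smoothAt_iff hn]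
  refine (contMDiffAt_const (c := v)).congr_of_eventuallyEq ?_
  filter_upwards [eventually_mem_baseSet (𝕜 := 𝕜) (F := F) x] with p hp
  rw [constField, Trivialization.continuousLinearMapAt_symmL _ hp]

/-- The axioms are tested on smooth fields; this extension turns them into identities between
tangent vectors. -/
theorem exists_smoothAt_eq (hn : ∞ ≤ n) [IsManifold 𝓘(𝕜, F) n M] (v : TangentSpace 𝓘(𝕜, F) x) :
    ∃ X : VField 𝕜 F M, X.SmoothAt n x ∧ X x = v :=
  ⟨constField x ((trivializationAt F (TangentSpace 𝓘(𝕜, F)) x).continuousLinearMapAt 𝕜 x v),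
    constField_smoothAt hn _, Trivialization.symmL_continuousLinearMapAt _
      (mem_baseSet_trivializationAt F (TangentSpace 𝓘(𝕜, F)) x) v⟩

variable [FiniteDimensional 𝕜 F] {L : (p : M) → Module.End 𝕜 (TangentSpace 𝓘(𝕜, F) p)}

theorem inTriv_apply {p : M} (hp : p ∈ (trivializationAt F (TangentSpace 𝓘(𝕜, F)) x).baseSet)
    (v : TangentSpace 𝓘(𝕜, F) p) :
    inTriv L x p ((trivializationAt F (TangentSpace 𝓘(𝕜, F)) x).continuousLinearMapAt 𝕜 p v) =
      (trivializationAt F (TangentSpace 𝓘(𝕜, F)) x).continuousLinearMapAt 𝕜 p (L p v) := by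
  change Trivialization.continuousLinearMapAt _ _ _ (L p (Trivialization.symmL _ _ _ _)) = _
  rw [Trivialization.symmL_continuousLinearMapAt _ hp]

theorem isUnit_inTriv_iff {p : M}
    (hp : p ∈ (trivializationAt F (TangentSpace 𝓘(𝕜, F)) x).baseSet) :
    IsUnit (inTriv L x p) ↔ IsUnit (L p) := by
  set e := trivializationAt F (TangentSpace 𝓘(𝕜, F)) x
  have h1 : IsUnit (inTriv L x p) ↔ IsUnit ((inTriv L x p : F →ₗ[𝕜] F)) := by
    constructor
    · exact fun h => h.map (ContinuousLinearMap.toLinearMapRingHom (R₁ := 𝕜) (M₁ := F))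
    · exact fun h => h.map (Module.End.toContinuousLinearMap (𝕜 := 𝕜) F)
  rw [h1, LinearMap.isUnit_iff_ker_eq_bot, LinearMap.isUnit_iff_ker_eq_bot,
    LinearMap.ker_eq_bot', LinearMap.ker_eq_bot']
  constructor
  · intro h v hv
    have h0 := h (e.continuousLinearMapAt 𝕜 p v)
      ((inTriv_apply hp v).trans (by rw [hv, map_zero]))
    rw [← e.symmL_continuousLinearMapAt (R := 𝕜) hp v, h0, map_zero]
  · intro h v hv
    rw [← e.continuousLinearMapAt_symmL (R := 𝕜) hp v] at hv ⊢
    have h0 := (inTriv_apply (L := L) hp (e.symmL 𝕜 p v)).symm.trans hv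
    rw [h (e.symmL 𝕜 p v) (by
      rw [← e.symmL_continuousLinearMapAt (R := 𝕜) hp (L p _), h0, map_zero]), map_zero]

/-- An endomorphism of `F` depends linearly on its values on a finite basis, and those values are
smooth because `L` is applied to fields constant in the trivialization. -/
theorem contMDiffAt_inTriv (hn : ∞ ≤ n) [IsManifold 𝓘(𝕜, F) n M]
    (hL : ∀ X : VField 𝕜 F M, X.SmoothAt n x → VField.SmoothAt n (fun p => L p (X p)) x) :
    ContMDiffAt 𝓘(𝕜, F) 𝓘(𝕜, F →L[𝕜] F) n (inTriv L x) x := by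
  let b := Module.finBasis 𝕜 F
  let Ψ : (F →ₗ[𝕜] F) ≃ₗ[𝕜] F →L[𝕜] F := LinearMap.toContinuousLinearMap
  let Φ : (Fin (Module.finrank 𝕜 F) → F) →L[𝕜] F →L[𝕜] F := LinearMap.toContinuousLinearMap
    (Ψ.toLinearMap.comp (b.constr 𝕜).toLinearMap)
  have h : inTriv L x = fun p => Φ fun i => inTriv L x p (b i) := by
    ext1 p
    apply ContinuousLinearMap.coe_injective
    refine b.ext fun i => ?_
    exact (b.constr_basis 𝕜 (fun j => inTriv L x p (b j)) i).symm
  rw [h]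
  refine Φ.contMDiff.contMDiffAt.comp x (contMDiffAt_pi_space.2 fun i => ?_)
  exact (VField.smoothAt_iff hn).1 (hL _ (constField_smoothAt hn (b i)))

/-- The units of the Banach algebra `F →L[𝕜] F` form an open set. -/
theorem eventually_isUnit (hn : ∞ ≤ n) [IsManifold 𝓘(𝕜, F) n M]
    (hL : ∀ X : VField 𝕜 F M, X.SmoothAt n x → VField.SmoothAt n (fun p => L p (X p)) x)
    (hu : IsUnit (L x)) : ∀ᶠ p in 𝓝 x, IsUnit (L p) := by
  have hux := (isUnit_inTriv_iff (mem_baseSet_trivializationAt F (TangentSpace 𝓘(𝕜, F)) x)).2 hu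
  have : CompleteSpace F := FiniteDimensional.complete 𝕜 F
  have := (contMDiffAt_inTriv hn hL).continuousAt.eventually (Units.isOpen.mem_nhds hux)
  filter_upwards [this, eventually_mem_baseSet (𝕜 := 𝕜) (F := F) x] with p hp hpb
  exact (isUnit_inTriv_iff hpb).1 hp

theorem contMDiffAt_inverse_inTriv (hn : ∞ ≤ n) [IsManifold 𝓘(𝕜, F) n M]
    (hL : ∀ X : VField 𝕜 F M, X.SmoothAt n x → VField.SmoothAt n (fun p => L p (X p)) x)
    (hu : IsUnit (L x)) :
    ContMDiffAt 𝓘(𝕜, F) 𝓘(𝕜, F →L[𝕜] F) n (fun p => Ring.inverse (inTriv L x p)) x := by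
  have : CompleteSpace F := FiniteDimensional.complete 𝕜 F
  obtain ⟨u, hux⟩ :=
    (isUnit_inTriv_iff (mem_baseSet_trivializationAt F (TangentSpace 𝓘(𝕜, F)) x)).2 hu
  have h := contDiffAt_ringInverse 𝕜 (n := n) u
  rw [hux] at h
  exact h.contMDiffAt.comp x (contMDiffAt_inTriv hn hL)

theorem eventually_inTriv_inverse (hn : ∞ ≤ n) [IsManifold 𝓘(𝕜, F) n M]
    (hL : ∀ X : VField 𝕜 F M, X.SmoothAt n x → VField.SmoothAt n (fun p => L p (X p)) x)
    (hu : IsUnit (L x)) (X : VField 𝕜 F M) : ∀ᶠ p in 𝓝 x,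
      (trivializationAt F (TangentSpace 𝓘(𝕜, F)) x).continuousLinearMapAt 𝕜 p
        (Ring.inverse (L p) (X p)) = Ring.inverse (inTriv L x p)
      ((trivializationAt F (TangentSpace 𝓘(𝕜, F)) x).continuousLinearMapAt 𝕜 p (X p)) := by
  filter_upwards [eventually_isUnit hn hL hu, eventually_mem_baseSet (𝕜 := 𝕜) (F := F) x]
    with p hp hpb
  have h := congrArg (fun f : F →L[𝕜] F => f
    ((trivializationAt F (TangentSpace 𝓘(𝕜, F)) x).continuousLinearMapAt 𝕜 p
      (Ring.inverse (L p) (X p))))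
    (Ring.inverse_mul_cancel _ ((isUnit_inTriv_iff (L := L) hpb).2 hp))
  refine h.symm.trans (congrArg (Ring.inverse (inTriv L x p) : F →L[𝕜] F) ?_)
  exact (inTriv_apply hpb _).trans (by rw [mul_inverse_apply hp])

theorem VField.SmoothAt.inverse (hn : ∞ ≤ n) [IsManifold 𝓘(𝕜, F) n M]
    (hL : ∀ X : VField 𝕜 F M, X.SmoothAt n x → VField.SmoothAt n (fun p => L p (X p)) x)
    (hu : IsUnit (L x)) {X : VField 𝕜 F M} (hX : X.SmoothAt n x) :
    VField.SmoothAt n (fun p => Ring.inverse (L p) (X p)) x := by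
  rw [smoothAt_iff hn] at *
  exact ((contMDiffAt_inverse_inTriv hn hL hu).clm_apply hX).congr_of_eventuallyEq
    (eventually_inTriv_inverse hn hL hu X)

/-- The additivity and Leibniz rules in `IsCovariantDerivativeOn` concern sections that are merely
differentiable, so the smooth version does not suffice for `∇_*`. -/
theorem mdifferentiableAt_inverse (hn : ∞ ≤ n) [IsManifold 𝓘(𝕜, F) n M]
    (hL : ∀ X : VField 𝕜 F M, X.SmoothAt n x → VField.SmoothAt n (fun p => L p (X p)) x)
    (hu : IsUnit (L x)) {X : VField 𝕜 F M}
    (hX : MDifferentiableAt 𝓘(𝕜, F) (𝓘(𝕜, F).prod 𝓘(𝕜, F))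
      (fun p => (⟨p, X p⟩ : TangentBundle 𝓘(𝕜, F) M)) x) :
    MDifferentiableAt 𝓘(𝕜, F) (𝓘(𝕜, F).prod 𝓘(𝕜, F))
      (fun p => (⟨p, Ring.inverse (L p) (X p)⟩ : TangentBundle 𝓘(𝕜, F) M)) x := by
  rw [VField.mdifferentiableAt_iff hn] at *
  refine (((contMDiffAt_inverse_inTriv hn hL hu).mdifferentiableAt
    (by rintro rfl; simp at hn)).clm_apply hX).congr_of_eventuallyEq
    (eventually_inTriv_inverse hn hL hu X)

end Regularity

/-! ### Consequences of the Frobenius axioms for `∇` and `∇E`. -/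

noncomputable section Frobenius

variable {𝕜 : Type*} [RCLike 𝕜] {F : Type*} [NormedAddCommGroup F] [NormedSpace 𝕜 F]
  {M : Type*} [TopologicalSpace M] [ChartedSpace F M]

/-- The endomorphism `v ↦ c v - ∇_v E` of the tangent spaces. -/
def slope (D : Conn 𝕜 F M) (E : VField 𝕜 F M) (c : 𝕜) (p : M) :
    Module.End 𝕜 (TangentSpace 𝓘(𝕜, F) p) := c • 1 - (D E p).toLinearMap

theorem slope_apply (D : Conn 𝕜 F M) (E : VField 𝕜 F M) (c : 𝕜) (p : M)
    (v : TangentSpace 𝓘(𝕜, F) p) : slope D E c p v = c • v - D E p v := rfl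

/-- The defect `∇_v (X · Y) - ∇_v X · Y - X · ∇_v Y` of the product rule. -/
def mulDeriv (A : AlgebraField 𝕜 F M) (D : Conn 𝕜 F M) (X Y : VField 𝕜 F M) (x : M)
    (v : TangentSpace 𝓘(𝕜, F) x) : TangentSpace 𝓘(𝕜, F) x :=
  D (A.mul X Y) x v - (A x).mul (D X x v) (Y x) - (A x).mul (X x) (D Y x v)

theorem lieFun_congr {X : VField 𝕜 F M} {f g : M → 𝕜} {x : M} (h : f =ᶠ[𝓝 x] g) :
    lieFun X f x = lieFun X g x := by
  simp only [lieFun, mvfderiv, h.mfderiv_eq]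
  rfl

theorem nablaC_swap_zero_one {x : M} {A : AlgebraField 𝕜 F M} {D : Conn 𝕜 F M}
    (hA : ∀ᶠ p in 𝓝 x, (A p).IsFrobeniusAlgebra)
    (X : Fin 4 → VField 𝕜 F M) : A.nablaC D (X ∘ Equiv.swap 0 1) x = A.nablaC D X x := by
  have h : ∀ Y Z W : VField 𝕜 F M, A.c Y Z W =ᶠ[𝓝 x] A.c Z Y W := fun Y Z W =>
    hA.mono fun p hp => by
      simp only [AlgebraField.c, pairing, AlgebraField.mul, hp.mul_comm (Y p)]
  have e0 : (X ∘ Equiv.swap 0 1) 0 = X 1 := rfl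
  have e1 : (X ∘ Equiv.swap 0 1) 1 = X 0 := rfl
  have e2 : (X ∘ Equiv.swap 0 1) 2 = X 2 := rfl
  have e3 : (X ∘ Equiv.swap 0 1) 3 = X 3 := rfl
  rw [AlgebraField.nablaC, AlgebraField.nablaC, e0, e1, e2, e3, lieFun_congr (h (X 1) _ _),
    (h (X 1) _ _).self_of_nhds, (h _ (X 0) _).self_of_nhds, (h (X 1) _ _).self_of_nhds]
  ring

theorem nablaC_swap_one_two {x : M} {A : AlgebraField 𝕜 F M} {D : Conn 𝕜 F M}
    (hA : ∀ᶠ p in 𝓝 x, (A p).IsFrobeniusAlgebra)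
    (X : Fin 4 → VField 𝕜 F M) : A.nablaC D (X ∘ Equiv.swap 1 2) x = A.nablaC D X x := by
  have h : ∀ Y Z W : VField 𝕜 F M, A.c Y Z W =ᶠ[𝓝 x] A.c Y W Z := fun Y Z W =>
    hA.mono fun p hp => by
      simp only [AlgebraField.c, pairing, AlgebraField.mul, AlgebraField.metric]
      rw [hp.invariant, hp.invariant, hp.mul_comm (Z p)]
  have e0 : (X ∘ Equiv.swap 1 2) 0 = X 0 := rfl
  have e1 : (X ∘ Equiv.swap 1 2) 1 = X 2 := rfl
  have e2 : (X ∘ Equiv.swap 1 2) 2 = X 1 := rfl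
  have e3 : (X ∘ Equiv.swap 1 2) 3 = X 3 := rfl
  rw [AlgebraField.nablaC, AlgebraField.nablaC, e0, e1, e2, e3, lieFun_congr (h _ (X 2) _),
    (h _ (X 2) (X 1)).self_of_nhds, (h _ (D.cov _ _) (X 1)).self_of_nhds,
    (h _ (X 2) (D.cov _ _)).self_of_nhds]
  ring

variable [IsManifold 𝓘(𝕜, F) 1 M] {n : ℕ∞ω} {x : M} {A : AlgebraField 𝕜 F M}
  {E : VField 𝕜 F M} {k c D₀ : 𝕜} {U : Set M} {D : Conn 𝕜 F M}

theorem nablaC_eq_form_mulDeriv (hD : IsLeviCivitaOn n A.metric U D) (hA : A.SmoothOn n U)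
    (hx : x ∈ U) {X : Fin 4 → VField 𝕜 F M} (hX : ∀ i, (X i).SmoothAt n x) :
    A.nablaC D X x = (A x).form (mulDeriv A D (X 0) (X 1) x (X 3 x)) (X 2 x) := by
  rw [AlgebraField.nablaC, AlgebraField.c, hD.metric x hx (X 3) (A.mul (X 0) (X 1)) (X 2) (hX 3)
    (hA.mul x hx _ _ (hX 0) (hX 1)) (hX 2)]
  simp only [mulDeriv, map_sub, LinearMap.sub_apply, pairing, AlgebraField.mul, Conn.cov,
    AlgebraField.metric, AlgebraField.c]
  abel

/-- The symmetry of `∇ c` follows from its symmetry under the exchange of the first and the last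
argument. -/
theorem nablaC_perm (hA : ∀ᶠ p in 𝓝 x, (A p).IsFrobeniusAlgebra)
    (h : ∀ X : Fin 4 → VField 𝕜 F M, (∀ i, (X i).SmoothAt n x) →
      A.nablaC D (X ∘ Equiv.swap 0 3) x = A.nablaC D X x) (σ : Equiv.Perm (Fin 4)) :
    ∀ X : Fin 4 → VField 𝕜 F M, (∀ i, (X i).SmoothAt n x) →
      A.nablaC D (X ∘ σ) x = A.nablaC D X x := by
  have hσ : σ ∈ Submonoid.closure (Set.range fun i : Fin 3 => Equiv.swap i.castSucc i.succ) := by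
    rw [Equiv.Perm.mclosure_swap_castSucc_succ]
    trivial
  induction hσ using Submonoid.closure_induction with
  | one => exact fun X _ => rfl
  | mul σ τ _ _ h1 h2 =>
    intro X hX
    rw [Equiv.Perm.coe_mul, ← Function.comp_assoc, h2 (X ∘ σ) fun i => hX (σ i), h1 X hX]
  | mem σ hσ =>
    obtain ⟨i, rfl⟩ := hσ
    intro X hX
    fin_cases i
    · exact nablaC_swap_zero_one hA X
    · exact nablaC_swap_one_two hA X
    -- The remaining adjacent transposition is the conjugate of `swap 0 3` by `swap 0 2`, itself a
    -- product of the two already treated.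
    · have hs : Equiv.swap (2 : Fin 4) 3 = Equiv.swap 0 1 * Equiv.swap 1 2 * Equiv.swap 0 1 *
          Equiv.swap 0 3 * (Equiv.swap 0 1 * Equiv.swap 1 2 * Equiv.swap 0 1) := by decide
      change A.nablaC D (X ∘ Equiv.swap (2 : Fin 4) 3) x = _
      simp only [hs, Equiv.Perm.coe_mul, ← Function.comp_assoc]
      rw [nablaC_swap_zero_one hA, nablaC_swap_one_two hA, nablaC_swap_zero_one hA,
        h (((X ∘ Equiv.swap 0 1) ∘ Equiv.swap 1 2) ∘ Equiv.swap 0 1) fun i => hX _,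
        nablaC_swap_zero_one hA, nablaC_swap_one_two hA,
        nablaC_swap_zero_one hA]

namespace AlgebraField.AxiomsExceptFlatUnity

theorem cov_smoothAt (h : A.AxiomsExceptFlatUnity n E k D₀ U D) (hx : x ∈ U)
    {X Y : VField 𝕜 F M} (hX : X.SmoothAt n x) (hY : Y.SmoothAt n x) :
    VField.SmoothAt n (fun p => D Y p (X p)) x :=
  h.leviCivita.smooth x hx X Y hX hY

theorem mul_smoothAt (h : A.AxiomsExceptFlatUnity n E k D₀ Set.univ D) {X Y : VField 𝕜 F M}
    (hX : X.SmoothAt n x) (hY : Y.SmoothAt n x) : (A.mul X Y).SmoothAt n x :=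
  h.smooth.mul x trivial X Y hX hY

theorem mul_euler_smoothAt (h : A.AxiomsExceptFlatUnity n E k D₀ Set.univ D) (X : VField 𝕜 F M)
    (hX : X.SmoothAt n x) : VField.SmoothAt n (fun p => (A p).mul (E p) (X p)) x :=
  h.mul_smoothAt (h.euler_smooth x trivial) hX

theorem slope_smoothAt (h : A.AxiomsExceptFlatUnity n E k D₀ U D) (hx : x ∈ U)
    (hn : ∞ ≤ n) [IsManifold 𝓘(𝕜, F) n M] {X : VField 𝕜 F M} (hX : X.SmoothAt n x) :
    VField.SmoothAt n (fun p => slope D E c p (X p)) x :=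
  (hX.const_smul hn c).sub hn (h.cov_smoothAt hx hX (h.euler_smooth x hx))

theorem cov_congr (h : A.AxiomsExceptFlatUnity n E k D₀ U D) (hU : U ∈ 𝓝 x)
    (hn : ∞ ≤ n) {X Y : VField 𝕜 F M} (hX : X.SmoothAt n x)
    (hXY : ∀ᶠ p in 𝓝 x, Y p = X p) : D Y x = D X x :=
  h.leviCivita.isCovariantDerivative.congr_of_eventuallyEq
    ((hX.congr hXY).mdifferentiableAt hn) (hX.mdifferentiableAt hn) hU hXY

theorem cov_add (h : A.AxiomsExceptFlatUnity n E k D₀ U D) (hx : x ∈ U) (hn : ∞ ≤ n)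
    {X Y : VField 𝕜 F M} (hX : X.SmoothAt n x) (hY : Y.SmoothAt n x)
    (v : TangentSpace 𝓘(𝕜, F) x) : D (X + Y) x v = D X x v + D Y x v :=
  congrArg (fun f => f v) (h.leviCivita.isCovariantDerivative.add
    (hX.mdifferentiableAt hn) (hY.mdifferentiableAt hn) hx)

theorem cov_smul (h : A.AxiomsExceptFlatUnity n E k D₀ U D) (hx : x ∈ U) (hn : ∞ ≤ n)
    {X : VField 𝕜 F M} (hX : X.SmoothAt n x) (a : 𝕜) (v : TangentSpace 𝓘(𝕜, F) x) :
    D (a • X) x v = a • D X x v :=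
  congrArg (fun f => f v) (h.leviCivita.isCovariantDerivative.smul_const a
    (hX.mdifferentiableAt hn) hx)

theorem bracket_eq (h : A.AxiomsExceptFlatUnity n E k D₀ U D) (hx : x ∈ U)
    {X Y : VField 𝕜 F M} (hX : X.SmoothAt n x) (hY : Y.SmoothAt n x) :
    bracket X Y x = D Y x (X x) - D X x (Y x) :=
  (h.leviCivita.torsion_free x hx X Y hX hY).symm

theorem bracket_congr (h : A.AxiomsExceptFlatUnity n E k D₀ U D) (hU : U ∈ 𝓝 x) (hn : ∞ ≤ n)
    {X Y Z : VField 𝕜 F M} (hX : X.SmoothAt n x) (hY : Y.SmoothAt n x)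
    (hYZ : ∀ᶠ p in 𝓝 x, Z p = Y p) : bracket X Z x = bracket X Y x := by
  have hx := mem_of_mem_nhds hU
  rw [h.bracket_eq hx hX hY, h.bracket_eq hx hX (hY.congr hYZ), h.cov_congr hU hn hY hYZ,
    hYZ.self_of_nhds]

/-- Nondegeneracy removes the third argument of `∇c`, leaving a vector identity from the exchange of
its first and last arguments. -/
theorem mulDeriv_symm (h : A.AxiomsExceptFlatUnity n E k D₀ U D) (hx : x ∈ U)
    (hn : ∞ ≤ n) [IsManifold 𝓘(𝕜, F) n M]
    {X Y W : VField 𝕜 F M} (hX : X.SmoothAt n x) (hY : Y.SmoothAt n x) (hW : W.SmoothAt n x) :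
    mulDeriv A D X Y x (W x) = mulDeriv A D W Y x (X x) := by
  refine (h.frobeniusAlgebra x hx).eq_of_form_eq fun z => ?_
  obtain ⟨Z, hZ, rfl⟩ := exists_smoothAt_eq hn z
  have h1 : ∀ i, (![X, Y, Z, W] i).SmoothAt n x := by intro i; fin_cases i <;> assumption
  have h2 := h.nablaC_symm x hx _ h1 (Equiv.swap 0 3)
  rw [nablaC_eq_form_mulDeriv h.leviCivita h.smooth hx h1,
    nablaC_eq_form_mulDeriv (X := ![X, Y, Z, W] ∘ Equiv.swap 0 3) h.leviCivita h.smooth hx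
      fun i => h1 _] at h2
  exact h2.symm

theorem mul_comm (h : A.AxiomsExceptFlatUnity n E k D₀ Set.univ D) (X Y : VField 𝕜 F M) :
    A.mul X Y = A.mul Y X :=
  funext fun p => (h.frobeniusAlgebra p trivial).mul_comm _ _

theorem mulDeriv_comm (h : A.AxiomsExceptFlatUnity n E k D₀ Set.univ D) (X Y : VField 𝕜 F M)
    (v : TangentSpace 𝓘(𝕜, F) x) : mulDeriv A D X Y x v = mulDeriv A D Y X x v := by
  have hA := h.frobeniusAlgebra x trivial
  rw [mulDeriv, mulDeriv, h.mul_comm, hA.mul_comm _ (Y x), hA.mul_comm (X x)]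
  abel

/-- The covariant derivative of `(X·Y)·Z = X·(Y·Z)`: a Hochschild cocycle condition. -/
theorem mulDeriv_mul (h : A.AxiomsExceptFlatUnity n E k D₀ Set.univ D) (X Y Z : VField 𝕜 F M)
    (v : TangentSpace 𝓘(𝕜, F) x) :
    mulDeriv A D (A.mul X Y) Z x v + (A x).mul (mulDeriv A D X Y x v) (Z x) =
      mulDeriv A D X (A.mul Y Z) x v + (A x).mul (X x) (mulDeriv A D Y Z x v) := by
  have hA := h.frobeniusAlgebra x trivial
  have h1 : A.mul (A.mul X Y) Z = A.mul X (A.mul Y Z) :=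
    funext fun p => (h.frobeniusAlgebra p trivial).mul_assoc _ _ _
  simp only [mulDeriv, h1, map_sub, LinearMap.sub_apply]
  simp only [AlgebraField.mul, hA.mul_assoc]
  abel

/-- Torsion-freeness replaces the brackets in the Euler axiom by covariant derivatives. The
contributions of `c` cancel on the right, so it stays free. -/
theorem mulDeriv_euler (h : A.AxiomsExceptFlatUnity n E 1 D₀ U D) (hx : x ∈ U) (c : 𝕜)
    {X Y : VField 𝕜 F M} (hX : X.SmoothAt n x) (hY : Y.SmoothAt n x) :
    mulDeriv A D X Y x (E x) = (1 - c) • (A x).mul (X x) (Y x)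
      - slope D E c x ((A x).mul (X x) (Y x)) + (A x).mul (slope D E c x (X x)) (Y x)
      + (A x).mul (X x) (slope D E c x (Y x)) := by
  have h1 := h.euler_mul x hx X Y hX hY
  have hE := h.euler_smooth x hx
  simp only [AlgebraField.mul] at h1
  rw [h.bracket_eq hx hE (h.smooth.mul x hx X Y hX hY), h.bracket_eq hx hE hX,
    h.bracket_eq hx hE hY] at h1
  simp only [slope_apply, mulDeriv, map_sub, map_smul, LinearMap.sub_apply,
    LinearMap.smul_apply] at h1 ⊢
  simp only [AlgebraField.mul] at h1 ⊢
  linear_combination (norm := module) h1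

/-- The Euler axiom on `e·e = e` gives `[E, e] = -e`, and `∇_E e = 0` removes one half of the
bracket. -/
theorem cov_euler_unit (h : A.AxiomsExceptFlatUnity n E 1 D₀ Set.univ D)
    (he : ∀ x : M, ∀ X : VField 𝕜 F M, X.SmoothAt n x → D.cov X A.unit x = 0) :
    D E x (A.unit x) = A.unit x := by
  have hu := h.smooth.unit x trivial
  have hE := h.euler_smooth x trivial
  have hA := h.frobeniusAlgebra x trivial
  have hm : A.mul A.unit A.unit = A.unit :=
    funext fun p => (h.frobeniusAlgebra p trivial).unit_mul _
  have h1 := h.euler_mul x trivial A.unit A.unit hu hu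
  have h2 : D A.unit x (E x) = 0 := he x E hE
  have h3 : ∀ X, A.mul A.unit X x = X x := fun X => hA.unit_mul _
  have h4 : ∀ X, A.mul X A.unit x = X x := fun X => (hA.mul_comm _ _).trans (hA.unit_mul _)
  rw [hm, h3, h4, h.bracket_eq trivial hE hu, h2] at h1
  linear_combination (norm := module) h1

/-- The conformal Killing equation for `E`. When `2c - D₀ = 1` it says that `1 - S` is the adjoint
of `S = c - ∇E`. -/
theorem form_slope (h : A.AxiomsExceptFlatUnity n E k D₀ U D) (hx : x ∈ U)
    (hn : ∞ ≤ n) [IsManifold 𝓘(𝕜, F) n M] (c : 𝕜) (v w : TangentSpace 𝓘(𝕜, F) x) :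
    (A x).form (slope D E c x v) w + (A x).form v (slope D E c x w) =
      (2 * c - D₀) * (A x).form v w := by
  obtain ⟨X, hX, rfl⟩ := exists_smoothAt_eq hn v
  obtain ⟨Y, hY, rfl⟩ := exists_smoothAt_eq hn w
  have hE := h.euler_smooth x hx
  have h1 := h.euler_metric x hx X Y hX hY
  rw [h.leviCivita.metric x hx E X Y hE hX hY] at h1
  simp only [pairing, Conn.cov, AlgebraField.metric] at h1
  rw [h.bracket_eq hx hE hX, h.bracket_eq hx hE hY] at h1
  simp only [slope_apply, map_sub, map_smul, LinearMap.sub_apply,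
    LinearMap.smul_apply, smul_eq_mul] at h1 ⊢
  linear_combination -h1

/-- Symmetry of `∇c` exchanges the derivative of the product with `E` along `v` for a derivative
along `E`, which the Euler axiom computes. -/
theorem cov_euler_mul (h : A.AxiomsExceptFlatUnity n E 1 D₀ U D) (hx : x ∈ U)
    (hn : ∞ ≤ n) [IsManifold 𝓘(𝕜, F) n M] (c : 𝕜)
    {X : VField 𝕜 F M} (hX : X.SmoothAt n x) (v : TangentSpace 𝓘(𝕜, F) x) :
    D (A.mul E X) x v = (A x).mul (E x) (D X x v) + (A x).mul v (X x)
      - slope D E c x ((A x).mul v (X x)) + (A x).mul v (slope D E c x (X x)) := by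
  obtain ⟨V, hV, rfl⟩ := exists_smoothAt_eq hn v
  have h1 := h.mulDeriv_symm hx hn (h.euler_smooth x hx) hX hV
  rw [h.mulDeriv_euler hx c hV hX, mulDeriv] at h1
  simp only [slope_apply, map_sub, map_smul, LinearMap.sub_apply, LinearMap.smul_apply] at h1 ⊢
  linear_combination (norm := module) h1

/-- This is `∇S = 0`, a restatement of `∇∇E = 0`. -/
theorem cov_slope (h : A.AxiomsExceptFlatUnity n E k D₀ U D) (hx : x ∈ U)
    (hn : ∞ ≤ n) [IsManifold 𝓘(𝕜, F) n M] (c : 𝕜)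
    {X : VField 𝕜 F M} (hX : X.SmoothAt n x) (v : TangentSpace 𝓘(𝕜, F) x) :
    D (fun p => slope D E c p (X p)) x v = slope D E c x (D X x v) := by
  obtain ⟨V, hV, rfl⟩ := exists_smoothAt_eq hn v
  have hE := h.cov_smoothAt hx hX (h.euler_smooth x hx)
  have h1 : D (fun p => D E p (X p)) x (V x) - D E x (D X x (V x)) = 0 :=
    h.euler_linear x hx V X hV hX
  have h2 : (fun p => slope D E c p (X p)) = c • X + (-1 : 𝕜) • fun p => D E p (X p) := by
    funext p
    simp [slope_apply, sub_eq_add_neg]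
  rw [h2, h.cov_add hx hn (hX.const_smul hn c) (hE.const_smul hn (-1)), h.cov_smul hx hn hX,
    h.cov_smul hx hn hE, slope_apply]
  linear_combination (norm := module) -h1

end AlgebraField.AxiomsExceptFlatUnity

end Frobenius

/-! ### The dual connection, and why it is the Levi-Civita connection of the dual metric. -/

noncomputable section Duality

variable {𝕜 : Type*} [RCLike 𝕜] {F : Type*} [NormedAddCommGroup F] [NormedSpace 𝕜 F]
  {M : Type*} [TopologicalSpace M] [ChartedSpace F M]

/-- The quotient `X / E` of vector fields. -/
def quot (A : AlgebraField 𝕜 F M) (E X : VField 𝕜 F M) : VField 𝕜 F M := fun p =>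
  Ring.inverse ((A p).mul (E p) : Module.End 𝕜 (TangentSpace 𝓘(𝕜, F) p)) (X p)

theorem quot_add (A : AlgebraField 𝕜 F M) (E X Y : VField 𝕜 F M) :
    quot A E (X + Y) = quot A E X + quot A E Y := funext fun _ => map_add _ _ _

theorem quot_smul (A : AlgebraField 𝕜 F M) (E X : VField 𝕜 F M) (f : M → 𝕜) :
    quot A E (f • X) = f • quot A E X := funext fun _ => map_smul _ _ _

variable [FiniteDimensional 𝕜 F]

/-- The connection `∇_{*,v} Y = E · ∇_v (Y / E) + v · (c - ∇E) (Y / E)`. -/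
def dualConn (A : AlgebraField 𝕜 F M) (E : VField 𝕜 F M) (D : Conn 𝕜 F M) (c : 𝕜) :
    Conn 𝕜 F M := fun Y p =>
  { toLinearMap := (A p).mul (E p) ∘ₗ (D (quot A E Y) p).toLinearMap +
      (A p).mul.flip (slope D E c p (quot A E Y p))
    cont := LinearMap.continuous_of_finiteDimensional (𝕜 := 𝕜) (E := F) (F' := F)
      ((A p).mul (E p) ∘ₗ (D (quot A E Y) p).toLinearMap +
        (A p).mul.flip (slope D E c p (quot A E Y p))) }

theorem dualConn_apply (A : AlgebraField 𝕜 F M) (E : VField 𝕜 F M) (D : Conn 𝕜 F M) (c : 𝕜)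
    (Y : VField 𝕜 F M) (p : M) (v : TangentSpace 𝓘(𝕜, F) p) :
    dualConn A E D c Y p v = (A p).mul (E p) (D (quot A E Y) p v) +
      (A p).mul v (slope D E c p (quot A E Y p)) := rfl

variable [IsManifold 𝓘(𝕜, F) 1 M] {n : ℕ∞ω} {x : M} {A : AlgebraField 𝕜 F M}
  {E : VField 𝕜 F M} {k c D₀ : 𝕜} {D : Conn 𝕜 F M}

namespace AlgebraField.AxiomsExceptFlatUnity

theorem mem_compl_discriminant_iff (h : A.AxiomsExceptFlatUnity n E k D₀ Set.univ D) :
    x ∈ (A.discriminant E)ᶜ ↔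
      IsUnit ((A x).mul (E x) : Module.End 𝕜 (TangentSpace 𝓘(𝕜, F) x)) :=
  (h.frobeniusAlgebra x trivial).gramDet_intersectionForm_ne_zero_iff

theorem mul_quot (h : A.AxiomsExceptFlatUnity n E k D₀ Set.univ D)
    (hx : x ∈ (A.discriminant E)ᶜ) (X : VField 𝕜 F M) : (A x).mul (E x) (quot A E X x) = X x :=
  mul_inverse_apply (h.mem_compl_discriminant_iff.1 hx) _

theorem quot_mul (h : A.AxiomsExceptFlatUnity n E k D₀ Set.univ D)
    (hx : x ∈ (A.discriminant E)ᶜ) (X : VField 𝕜 F M) : quot A E (A.mul E X) x = X x :=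
  inverse_mul_apply (h.mem_compl_discriminant_iff.1 hx) _

theorem quot_unit (h : A.AxiomsExceptFlatUnity n E k D₀ Set.univ D)
    (hx : x ∈ (A.discriminant E)ᶜ) : quot A E E x = A.unit x := by
  have hA := h.frobeniusAlgebra x trivial
  have h1 := h.quot_mul hx A.unit
  rwa [quot, AlgebraField.mul, AlgebraField.unit, hA.mul_comm, hA.unit_mul] at h1

theorem dual_form (h : A.AxiomsExceptFlatUnity n E k D₀ Set.univ D)
    (hx : x ∈ (A.discriminant E)ᶜ) (X Y : VField 𝕜 F M) :
    pairing (A.dual E).metric X Y x = pairing A.metric (quot A E X) Y x :=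
  (h.frobeniusAlgebra x trivial).dual_form_apply (h.mem_compl_discriminant_iff.1 hx) _ _

theorem dual_mul_right (h : A.AxiomsExceptFlatUnity n E k D₀ Set.univ D)
    (hx : x ∈ (A.discriminant E)ᶜ) (v : TangentSpace 𝓘(𝕜, F) x) (Y : VField 𝕜 F M) :
    ((A.dual E) x).mul v (Y x) = (A x).mul v (quot A E Y x) :=
  ((h.frobeniusAlgebra x trivial).mul_inverse (h.mem_compl_discriminant_iff.1 hx) v (Y x)).symm

theorem dual_mul_left (h : A.AxiomsExceptFlatUnity n E k D₀ Set.univ D)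
    (hx : x ∈ (A.discriminant E)ᶜ) (X : VField 𝕜 F M) (v : TangentSpace 𝓘(𝕜, F) x) :
    ((A.dual E) x).mul (X x) v = (A x).mul (quot A E X x) v := by
  have hA := h.frobeniusAlgebra x trivial
  exact ((hA.dual (h.mem_compl_discriminant_iff.1 hx)).mul_comm _ _).trans
    ((h.dual_mul_right hx v X).trans (hA.mul_comm _ _))

variable [IsManifold 𝓘(𝕜, F) n M]

theorem compl_discriminant_mem_nhds (h : A.AxiomsExceptFlatUnity n E k D₀ Set.univ D)
    (hn : ∞ ≤ n) (hx : x ∈ (A.discriminant E)ᶜ) : (A.discriminant E)ᶜ ∈ 𝓝 x :=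
  (eventually_isUnit (L := fun p => (A p).mul (E p)) hn h.mul_euler_smoothAt
    (h.mem_compl_discriminant_iff.1 hx)).mono fun _ hp => h.mem_compl_discriminant_iff.2 hp

theorem quot_smoothAt (h : A.AxiomsExceptFlatUnity n E k D₀ Set.univ D) (hn : ∞ ≤ n)
    (hx : x ∈ (A.discriminant E)ᶜ) {X : VField 𝕜 F M} (hX : X.SmoothAt n x) :
    (quot A E X).SmoothAt n x :=
  VField.SmoothAt.inverse (L := fun p => (A p).mul (E p)) hn h.mul_euler_smoothAt
    (h.mem_compl_discriminant_iff.1 hx) hX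

theorem quot_mdifferentiableAt (h : A.AxiomsExceptFlatUnity n E k D₀ Set.univ D) (hn : ∞ ≤ n)
    (hx : x ∈ (A.discriminant E)ᶜ) {X : VField 𝕜 F M}
    (hX : MDifferentiableAt 𝓘(𝕜, F) (𝓘(𝕜, F).prod 𝓘(𝕜, F))
      (fun p => (⟨p, X p⟩ : TangentBundle 𝓘(𝕜, F) M)) x) :
    MDifferentiableAt 𝓘(𝕜, F) (𝓘(𝕜, F).prod 𝓘(𝕜, F))
      (fun p => (⟨p, quot A E X p⟩ : TangentBundle 𝓘(𝕜, F) M)) x :=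
  mdifferentiableAt_inverse (L := fun p => (A p).mul (E p)) hn h.mul_euler_smoothAt
    (h.mem_compl_discriminant_iff.1 hx) hX

theorem eventually_mul_quot (h : A.AxiomsExceptFlatUnity n E k D₀ Set.univ D) (hn : ∞ ≤ n)
    (hx : x ∈ (A.discriminant E)ᶜ) (X : VField 𝕜 F M) :
    ∀ᶠ p in 𝓝 x, A.mul E (quot A E X) p = X p :=
  mem_of_superset (h.compl_discriminant_mem_nhds hn hx) fun _ hp => h.mul_quot hp X

/-- A field smooth at a point off the discriminant is the product of `E` with a smooth field, which
gives its covariant derivative. -/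
theorem cov_eq (h : A.AxiomsExceptFlatUnity n E 1 D₀ Set.univ D) (hn : ∞ ≤ n)
    (hx : x ∈ (A.discriminant E)ᶜ) (c : 𝕜) {X : VField 𝕜 F M} (hX : X.SmoothAt n x)
    (v : TangentSpace 𝓘(𝕜, F) x) :
    D X x v = dualConn A E D c X x v + (A x).mul v (quot A E X x)
      - slope D E c x ((A x).mul v (quot A E X x)) := by
  rw [← h.cov_congr univ_mem hn hX (h.eventually_mul_quot hn hx X),
    h.cov_euler_mul trivial hn c (h.quot_smoothAt hn hx hX), dualConn_apply]
  abel

theorem dualConn_smoothAt (h : A.AxiomsExceptFlatUnity n E k D₀ Set.univ D) (hn : ∞ ≤ n)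
    (hx : x ∈ (A.discriminant E)ᶜ) (c : 𝕜) {X Y : VField 𝕜 F M} (hX : X.SmoothAt n x)
    (hY : Y.SmoothAt n x) : VField.SmoothAt n (fun p => dualConn A E D c Y p (X p)) x :=
  have hq := h.quot_smoothAt hn hx hY
  (h.mul_euler_smoothAt _ (h.cov_smoothAt trivial hX hq)).add hn
    (h.mul_smoothAt hX (h.slope_smoothAt trivial hn hq))

/-- By `cov_eq` the difference `∇ - ∇_*` depends only on `X·(Y/E)`, which is symmetric in `X` and
`Y`. -/
theorem dualConn_torsion_free (h : A.AxiomsExceptFlatUnity n E 1 D₀ Set.univ D) (hn : ∞ ≤ n)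
    (hx : x ∈ (A.discriminant E)ᶜ) (c : 𝕜) {X Y : VField 𝕜 F M} (hX : X.SmoothAt n x)
    (hY : Y.SmoothAt n x) :
    dualConn A E D c Y x (X x) - dualConn A E D c X x (Y x) = bracket X Y x := by
  have hA := h.frobeniusAlgebra x trivial
  have h1 : (A x).mul (X x) (quot A E Y x) = (A x).mul (Y x) (quot A E X x) := by
    rw [← h.mul_quot hx X, ← h.mul_quot hx Y, hA.mul_assoc, hA.mul_assoc,
      hA.mul_comm (quot A E X x)]
  rw [h.bracket_eq trivial hX hY, h.cov_eq hn hx c hX, h.cov_eq hn hx c hY, h1]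
  abel

theorem dualConn_isCovariantDerivativeOn (h : A.AxiomsExceptFlatUnity n E k D₀ Set.univ D)
    (hn : ∞ ≤ n) (c : 𝕜) :
    IsCovariantDerivativeOn F (dualConn A E D c) (A.discriminant E)ᶜ where
  add {X Y p} hX hY hp := by
    refine ContinuousLinearMap.ext fun v => ?_
    have h1 := h.leviCivita.isCovariantDerivative.add (h.quot_mdifferentiableAt hn hp hX)
      (h.quot_mdifferentiableAt hn hp hY)
    rw [add_apply, dualConn_apply, dualConn_apply, dualConn_apply, quot_add,
      h1]
    simp only [Pi.add_apply, map_add, add_apply]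
    abel
  leibniz {X f p} hX hf hp := by
    refine ContinuousLinearMap.ext fun v => ?_
    have h1 := h.leviCivita.isCovariantDerivative.leibniz (h.quot_mdifferentiableAt hn hp hX) hf
    have h2 := h.mul_quot hp X
    simp only [add_apply, smul_apply,
      ContinuousLinearMap.smulRight_apply, dualConn_apply, quot_smul, h1, Pi.smul_apply', map_add,
      map_smul, h2]
    module

theorem dualConn_metric (h : A.AxiomsExceptFlatUnity n E 1 D₀ Set.univ D) (hn : ∞ ≤ n)
    (hx : x ∈ (A.discriminant E)ᶜ) (hc : 2 * c - D₀ = 1) {X Y Z : VField 𝕜 F M}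
    (hX : X.SmoothAt n x) (hY : Y.SmoothAt n x) (hZ : Z.SmoothAt n x) :
    lieFun X (pairing (A.dual E).metric Y Z) x =
      pairing (A.dual E).metric (fun p => dualConn A E D c Y p (X p)) Z x +
      pairing (A.dual E).metric Y (fun p => dualConn A E D c Z p (X p)) x := by
  have hA := h.frobeniusAlgebra x trivial
  have hY' := h.quot_smoothAt hn hx hY
  have h1 : pairing (A.dual E).metric Y Z =ᶠ[𝓝 x] pairing A.metric (quot A E Y) Z :=
    mem_of_superset (h.compl_discriminant_mem_nhds hn hx) fun _ hp => h.dual_form hp Y Z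
  have h2 : lieFun X (pairing (A.dual E).metric Y Z) x =
      lieFun X (pairing A.metric (quot A E Y) Z) x := lieFun_congr h1
  rw [h2, h.leviCivita.metric x trivial X _ Z hX hY' hZ, h.dual_form hx, h.dual_form hx]
  have h3 : (A x).form (quot A E (fun p => dualConn A E D c Y p (X p)) x) (Z x) =
      (A x).form (dualConn A E D c Y x (X x)) (quot A E Z x) :=
    (hA.form_inverse (h.mem_compl_discriminant_iff.1 hx) _ _).symm
  -- With `S` having adjoint `1 - S`, the term `S(Y/E)` in `∇_* Y` balances the correction `(1 -
  -- S)(X·(Z/E))` between `∇_X Z` and `∇_{*,X} Z`.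
  have h4 := h.form_slope trivial hn c (quot A E Y x) ((A x).mul (X x) (quot A E Z x))
  have h5 := h.cov_eq hn hx c hZ (X x)
  simp only [pairing, AlgebraField.metric, Conn.cov, h3, h5]
  rw [dualConn_apply A E D c Y, map_add, LinearMap.add_apply, hA.form_mul_left (X x),
    hA.form_mul_left (E x), h.mul_quot hx]
  simp only [map_add, map_sub]
  rw [hc] at h4
  linear_combination -h4

end AlgebraField.AxiomsExceptFlatUnity

end Duality

/-! ### Flatness, symmetry of `∇_* c_*` and the Euler axioms of the dual structure. -/

noncomputable section DualAxioms

variable {𝕜 : Type*} [RCLike 𝕜] {F : Type*} [NormedAddCommGroup F] [NormedSpace 𝕜 F]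
  [FiniteDimensional 𝕜 F] {M : Type*} [TopologicalSpace M] [ChartedSpace F M]
  [IsManifold 𝓘(𝕜, F) 1 M] {n : ℕ∞ω} [IsManifold 𝓘(𝕜, F) n M] {x : M} {A : AlgebraField 𝕜 F M}
  {E : VField 𝕜 F M} {k c d D₀ : 𝕜} {D : Conn 𝕜 F M}

namespace AlgebraField.AxiomsExceptFlatUnity

theorem isLeviCivitaOn_dualConn (h : A.AxiomsExceptFlatUnity n E 1 D₀ Set.univ D) (hn : ∞ ≤ n)
    (hc : 2 * c - D₀ = 1) :
    IsLeviCivitaOn n (A.dual E).metric (A.discriminant E)ᶜ (dualConn A E D c) where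
  isCovariantDerivative := h.dualConn_isCovariantDerivativeOn hn c
  smooth _ hx _ _ hX hY := h.dualConn_smoothAt hn hx c hX hY
  torsion_free _ hx _ _ hX hY := h.dualConn_torsion_free hn hx c hX hY
  metric _ hx _ _ _ hX hY hZ := h.dualConn_metric hn hx hc hX hY hZ

theorem dual_smoothOn (h : A.AxiomsExceptFlatUnity n E k D₀ Set.univ D) (hn : ∞ ≤ n) :
    (A.dual E).SmoothOn n (A.discriminant E)ᶜ where
  mul _ hx _ _ hX hY := h.quot_smoothAt hn hx (h.mul_smoothAt hX hY)
  metric x hx X Y hX hY :=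
    (h.smooth.metric x trivial _ Y (h.quot_smoothAt hn hx hX) hY).congr_of_eventuallyEq
      (mem_of_superset (h.compl_discriminant_mem_nhds hn hx) fun _ hp => h.dual_form hp X Y)
  unit x _ := h.euler_smooth x trivial

/-- A formula for `∇_{*,X} (∇_{*,Y} Z)`, in which all the terms after the second one are symmetric
in `X` and `Y`. -/
theorem dualConn_dualConn (h : A.AxiomsExceptFlatUnity n E 1 D₀ Set.univ D) (hn : ∞ ≤ n)
    (hx : x ∈ (A.discriminant E)ᶜ) (c : 𝕜) {X Y Z : VField 𝕜 F M}
    (hY : Y.SmoothAt n x) (hZ : Z.SmoothAt n x) :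
    dualConn A E D c (fun p => dualConn A E D c Z p (Y p)) x (X x) =
      (A x).mul (E x) (D (fun p => D (quot A E Z) p (Y p)) x (X x))
      + (A x).mul (D Y x (X x)) (slope D E c x (quot A E Z x))
      + mulDeriv A D Y (fun p => slope D E c p (quot A E Z p)) x (X x)
      + ((A x).mul (Y x) (slope D E c x (D (quot A E Z) x (X x)))
        + (A x).mul (X x) (slope D E c x (D (quot A E Z) x (Y x))))
      + (slope D E c x (Ring.inverse ((A x).mul (E x) : Module.End 𝕜 (TangentSpace 𝓘(𝕜, F) x))
          ((A x).mul ((A x).mul (X x) (Y x)) (slope D E c x (quot A E Z x))))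
        - Ring.inverse ((A x).mul (E x) : Module.End 𝕜 (TangentSpace 𝓘(𝕜, F) x))
          ((A x).mul ((A x).mul (X x) (Y x)) (slope D E c x (quot A E Z x)))) := by
  have hA := h.frobeniusAlgebra x trivial
  have hU := h.mem_compl_discriminant_iff.1 hx
  have hz := h.quot_smoothAt hn hx hZ
  have hSz := h.slope_smoothAt (c := c) trivial hn hz
  have hQ := h.mul_smoothAt hY hSz
  have hP := h.quot_smoothAt hn hx hQ
  have hYz := h.cov_smoothAt trivial hY hz
  have hq : ∀ᶠ p in 𝓝 x, quot A E (fun p => dualConn A E D c Z p (Y p)) p =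
      ((fun p => D (quot A E Z) p (Y p)) +
        quot A E (A.mul Y fun p => slope D E c p (quot A E Z p))) p := by
    filter_upwards [h.compl_discriminant_mem_nhds hn hx] with p hp
    simp only [quot, dualConn_apply, map_add, Pi.add_apply, AlgebraField.mul]
    rw [inverse_mul_apply (h.mem_compl_discriminant_iff.1 hp)]
  -- With `Q = Y·S(Z/E)`, the terms containing `Q/E` assemble into `∇_{*,X} Q`, which is expressed
  -- here through `∇_X Q`.
  have h1 := h.cov_eq hn hx c hQ (X x)
  rw [dualConn_apply] at h1
  have h2 := h.cov_slope trivial hn c hz (X x)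
  have h3 : mulDeriv A D Y (fun p => slope D E c p (quot A E Z p)) x (X x) =
      D (A.mul Y fun p => slope D E c p (quot A E Z p)) x (X x)
      - (A x).mul (D Y x (X x)) (slope D E c x (quot A E Z x))
      - (A x).mul (Y x) (D (fun p => slope D E c p (quot A E Z p)) x (X x)) := rfl
  rw [h2] at h3
  have h4 : (A x).mul (X x) (quot A E (A.mul Y fun p => slope D E c p (quot A E Z p)) x) =
      Ring.inverse ((A x).mul (E x) : Module.End 𝕜 (TangentSpace 𝓘(𝕜, F) x))
        ((A x).mul ((A x).mul (X x) (Y x)) (slope D E c x (quot A E Z x))) := by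
    rw [quot, hA.mul_inverse hU, AlgebraField.mul, hA.mul_assoc]
  rw [h4] at h1
  rw [dualConn_apply, h.cov_congr univ_mem hn (hYz.add hn hP) hq, h.cov_add trivial hn hYz hP,
    hq.self_of_nhds]
  simp only [Pi.add_apply, map_add] at h1 ⊢
  linear_combination (norm := module) -h1 - h3

/-- After antisymmetrization, the second derivatives give `E·R(X, Y)(Z/E) = 0`, the `∇_X Y` terms
cancel against the bracket, and the `mulDeriv` terms cancel by symmetry of `∇c`. No condition on `c`
is needed. -/
theorem dualConn_flat (h : A.AxiomsExceptFlatUnity n E 1 D₀ Set.univ D) (hn : ∞ ≤ n)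
    (hx : x ∈ (A.discriminant E)ᶜ) (c : 𝕜) {X Y Z : VField 𝕜 F M}
    (hX : X.SmoothAt n x) (hY : Y.SmoothAt n x) (hZ : Z.SmoothAt n x) :
    (dualConn A E D c).curvature X Y Z x = 0 := by
  have hA := h.frobeniusAlgebra x trivial
  have hz := h.quot_smoothAt hn hx hZ
  have h1 := congrArg ((A x).mul (E x)) (h.flat x trivial X Y _ hX hY hz)
  have h2 := h.mulDeriv_symm trivial hn hY (h.slope_smoothAt (c := c) trivial hn hz) hX
  have h3 : (dualConn A E D c).curvature X Y Z x =
    dualConn A E D c (fun p => dualConn A E D c Z p (Y p)) x (X x)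
    - dualConn A E D c (fun p => dualConn A E D c Z p (X p)) x (Y x)
    - dualConn A E D c Z x (bracket X Y x) := rfl
  have h4 : D.curvature X Y (quot A E Z) x =
    D (fun p => D (quot A E Z) p (Y p)) x (X x) - D (fun p => D (quot A E Z) p (X p)) x (Y x)
    - D (quot A E Z) x (bracket X Y x) := rfl
  rw [h4] at h1
  rw [h3, h.dualConn_dualConn hn hx c hY hZ, h.dualConn_dualConn hn hx c hX hZ,
    dualConn_apply, hA.mul_comm (Y x) (X x), h2]
  rw [h.bracket_eq trivial hX hY] at h1 ⊢
  simp only [map_sub, map_zero, LinearMap.sub_apply] at h1 ⊢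
  linear_combination (norm := module) h1

theorem eventually_quot_dual_mul (h : A.AxiomsExceptFlatUnity n E k D₀ Set.univ D)
    (hn : ∞ ≤ n) (hx : x ∈ (A.discriminant E)ᶜ) (X Y : VField 𝕜 F M) :
    ∀ᶠ p in 𝓝 x, quot A E ((A.dual E).mul X Y) p = A.mul (quot A E X) (quot A E Y) p := by
  filter_upwards [h.compl_discriminant_mem_nhds hn hx] with p hp
  have hA := h.frobeniusAlgebra p trivial
  have hU := h.mem_compl_discriminant_iff.1 hp
  change _ = (A p).mul (quot A E X p)
    (Ring.inverse ((A p).mul (E p) : Module.End 𝕜 (TangentSpace 𝓘(𝕜, F) p)) (Y p))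
  rw [hA.mul_inverse hU, hA.mul_comm _ (Y p), quot, quot, hA.mul_inverse hU, hA.mul_comm (Y p)]
  rfl

theorem dualConn_mulDeriv (h : A.AxiomsExceptFlatUnity n E k D₀ Set.univ D) (hn : ∞ ≤ n)
    (hx : x ∈ (A.discriminant E)ᶜ) (c : 𝕜) {X Y : VField 𝕜 F M}
    (hX : X.SmoothAt n x) (hY : Y.SmoothAt n x) (w : TangentSpace 𝓘(𝕜, F) x) :
    mulDeriv (A.dual E) (dualConn A E D c) X Y x ((A x).mul (E x) w) =
      (A x).mul (E x) (mulDeriv A D (quot A E X) (quot A E Y) x ((A x).mul (E x) w)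
        + (A x).mul w (slope D E c x ((A x).mul (quot A E X x) (quot A E Y x))
          - (A x).mul (slope D E c x (quot A E X x)) (quot A E Y x)
          - (A x).mul (quot A E X x) (slope D E c x (quot A E Y x)))) := by
  have hA := h.frobeniusAlgebra x trivial
  have hU := h.mem_compl_discriminant_iff.1 hx
  have hab := h.mul_smoothAt (h.quot_smoothAt hn hx hX) (h.quot_smoothAt hn hx hY)
  have hq := h.eventually_quot_dual_mul hn hx X Y
  rw [mulDeriv, h.dual_mul_right hx, h.dual_mul_left hx, dualConn_apply, dualConn_apply, dualConn_apply,
    h.cov_congr univ_mem hn hab hq, hq.self_of_nhds, mulDeriv]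
  simp only [map_add, map_sub, LinearMap.add_apply, AlgebraField.mul]
  rw [hA.mul_left_comm (quot A E X x) (E x), hA.mul_left_comm (quot A E X x) ((A x).mul (E x) w)]
  simp only [hA.mul_assoc]
  abel

theorem dual_mulDeriv_symm (h : A.AxiomsExceptFlatUnity n E 1 D₀ Set.univ D) (hn : ∞ ≤ n)
    (hx : x ∈ (A.discriminant E)ᶜ) (c : 𝕜) {X Y W : VField 𝕜 F M}
    (hX : X.SmoothAt n x) (hY : Y.SmoothAt n x) (hW : W.SmoothAt n x) :
    mulDeriv (A.dual E) (dualConn A E D c) X Y x (W x) =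
      mulDeriv (A.dual E) (dualConn A E D c) W Y x (X x) := by
  have hA := h.frobeniusAlgebra x trivial
  have hE := h.euler_smooth x trivial
  have ha := h.quot_smoothAt hn hx hX
  have hb := h.quot_smoothAt hn hx hY
  have hw := h.quot_smoothAt hn hx hW
  -- The first two terms on the right are symmetric in `a` and `w`. The last is a derivative along
  -- `E`; computed by `mulDeriv_euler`, it compensates the asymmetry of the `slope` terms in
  -- `dualConn_mulDeriv`.
  have key : ∀ {a w : VField 𝕜 F M}, a.SmoothAt n x → w.SmoothAt n x →
      mulDeriv A D a (quot A E Y) x ((A x).mul (E x) (w x)) =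
        mulDeriv A D E (A.mul w a) x (quot A E Y x)
        + (A x).mul (E x) (mulDeriv A D w a x (quot A E Y x))
        - (A x).mul (mulDeriv A D w (quot A E Y) x (E x)) (a x) := by
    intro a w ha hw
    have hEw := h.mul_smoothAt hE hw
    have h1 := h.mulDeriv_symm trivial hn ha hb hEw
    rw [h.mulDeriv_comm (A.mul E w), h.mulDeriv_symm trivial hn hb hEw ha,
      h.mulDeriv_comm _ (A.mul E w)] at h1
    change mulDeriv A D a (quot A E Y) x ((A x).mul (E x) (w x)) = _ at h1
    have h2 := h.mulDeriv_mul E w a (quot A E Y x)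
    rw [h.mulDeriv_symm trivial hn hE hw hb, h.mulDeriv_comm _ w] at h2
    linear_combination (norm := module) h1 + h2
  rw [← h.mul_quot hx X, ← h.mul_quot hx W, h.dualConn_mulDeriv hn hx c hX hY,
    h.dualConn_mulDeriv hn hx c hW hY, key ha hw, key hw ha, h.mulDeriv_euler trivial c hw hb,
    h.mulDeriv_euler trivial c ha hb, h.mul_comm (quot A E X), h.mulDeriv_comm (quot A E X)]
  congr 1
  simp only [map_add, map_sub, map_smul, LinearMap.add_apply, LinearMap.sub_apply,
    LinearMap.smul_apply]
  simp only [hA.mul_assoc, hA.mul_comm, hA.mul_left_comm]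
  module

/-- Here `E/E = e` is flat and `∇_e E = e`, so `S e = (c - 1) e` is all that survives. -/
theorem dualConn_euler (h : A.AxiomsExceptFlatUnity n E 1 D₀ Set.univ D) (hn : ∞ ≤ n)
    (he : ∀ x : M, ∀ X : VField 𝕜 F M, X.SmoothAt n x → D.cov X A.unit x = 0)
    (hx : x ∈ (A.discriminant E)ᶜ) (c : 𝕜) (v : TangentSpace 𝓘(𝕜, F) x) :
    dualConn A E D c E x v = (c - 1) • v := by
  have hA := h.frobeniusAlgebra x trivial
  have hq : ∀ᶠ p in 𝓝 x, quot A E E p = A.unit p :=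
    mem_of_superset (h.compl_discriminant_mem_nhds hn hx) fun _ hp => h.quot_unit hp
  have h2 : D A.unit x v = 0 := by
    obtain ⟨V, hV, rfl⟩ := exists_smoothAt_eq hn v
    exact he x V hV
  have h3 : (A x).mul v (A.unit x) = v := (hA.mul_comm _ _).trans (hA.unit_mul _)
  rw [dualConn_apply, h.cov_congr univ_mem hn (h.smooth.unit x trivial) hq, h2, h.quot_unit hx,
    slope_apply, h.cov_euler_unit he, map_zero, map_sub, map_smul, h3]
  module

/-- The Euler axiom applied to `E·(X/E)`, with `[E, E] = 0`: division by `E` lowers the weight by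
one. -/
theorem bracket_euler (h : A.AxiomsExceptFlatUnity n E 1 D₀ Set.univ D) (hn : ∞ ≤ n)
    (hx : x ∈ (A.discriminant E)ᶜ) {X : VField 𝕜 F M} (hX : X.SmoothAt n x) :
    bracket E X x = X x + (A x).mul (E x) (bracket E (quot A E X) x) := by
  have hE := h.euler_smooth x trivial
  have h1 := h.euler_mul x trivial E _ hE (h.quot_smoothAt hn hx hX)
  rw [h.bracket_congr univ_mem hn hE hX (h.eventually_mul_quot hn hx X)] at h1
  simp only [AlgebraField.mul] at h1
  rw [h.mul_quot hx, h.bracket_eq trivial hE hE, sub_self, map_zero, LinearMap.zero_apply] at h1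
  linear_combination (norm := module) h1

/-- The constant `(3 - d)/2` is the solution of `2c - (2 - d) = 1`, a condition needed only for
`∇_*` to be metric. -/
theorem dual_axiomsExceptFlatUnity (h : A.AxiomsExceptFlatUnity n E 1 (2 - d) Set.univ D)
    (hn : ∞ ≤ n) (he : ∀ x : M, ∀ X : VField 𝕜 F M, X.SmoothAt n x → D.cov X A.unit x = 0) :
    (A.dual E).AxiomsExceptFlatUnity n E 0 (1 - d) (A.discriminant E)ᶜ
      (dualConn A E D ((3 - d) / 2)) where
  frobeniusAlgebra x hx :=
    (h.frobeniusAlgebra x trivial).dual (h.mem_compl_discriminant_iff.1 hx)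
  smooth := h.dual_smoothOn hn
  leviCivita := h.isLeviCivitaOn_dualConn hn (by ring)
  flat _ hx _ _ _ hX hY hZ := h.dualConn_flat hn hx _ hX hY hZ
  nablaC_symm x hx X hX σ := by
    have hLC := h.isLeviCivitaOn_dualConn (c := (3 - d) / 2) hn (by ring)
    refine nablaC_perm (mem_of_superset (h.compl_discriminant_mem_nhds hn hx) fun p hp =>
      (h.frobeniusAlgebra p trivial).dual (h.mem_compl_discriminant_iff.1 hp))
      (fun Y hY => ?_) σ X hX
    change (A.dual E).nablaC _ _ x = (A.dual E).nablaC _ _ x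
    rw [nablaC_eq_form_mulDeriv hLC (h.dual_smoothOn hn) hx hY,
      nablaC_eq_form_mulDeriv (X := Y ∘ Equiv.swap 0 3) hLC (h.dual_smoothOn hn) hx fun i => hY _]
    exact congrArg (fun v => ((A.dual E) x).form v (Y 2 x))
      (h.dual_mulDeriv_symm hn hx _ (hY 3) (hY 1) (hY 0))
  euler_smooth x _ := h.euler_smooth x trivial
  euler_linear x hx X Y hX hY := by
    have hD := h.dualConn_isCovariantDerivativeOn hn ((3 - d) / 2)
    have hU := h.compl_discriminant_mem_nhds hn hx
    have h1 : ∀ᶠ p in 𝓝 x, (dualConn A E D ((3 - d) / 2)).cov Y E p =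
        (((3 - d) / 2 - 1) • Y) p :=
      mem_of_superset hU fun p hp => h.dualConn_euler hn he hp _ _
    have hY' := hY.const_smul hn ((3 - d) / 2 - 1)
    have h2 : dualConn A E D ((3 - d) / 2) ((dualConn A E D ((3 - d) / 2)).cov Y E) x =
        ((3 - d) / 2 - 1) • dualConn A E D ((3 - d) / 2) Y x :=
      (hD.congr_of_eventuallyEq ((hY'.congr h1).mdifferentiableAt hn) (hY'.mdifferentiableAt hn)
        hU h1).trans (hD.smul_const _ (hY.mdifferentiableAt hn) hx)
    rw [Conn.cov, h2, Conn.cov, h.dualConn_euler hn he hx]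
    exact sub_self _
  euler_mul x hx X Y hX hY := by
    have hA := h.frobeniusAlgebra x trivial
    have hE := h.euler_smooth x trivial
    have ha := h.quot_smoothAt hn hx hX
    have hb := h.quot_smoothAt hn hx hY
    have hU := h.mem_compl_discriminant_iff.1 hx
    have h1 := congrArg ((A x).mul (E x)) (h.euler_mul x trivial _ _ ha hb)
    have h2 : ∀ X Y : VField 𝕜 F M, (A.dual E).mul X Y x = ((A.dual E) x).mul (X x) (Y x) :=
      fun _ _ => rfl
    rw [h.bracket_euler hn hx ((h.dual_smoothOn hn).mul x hx X Y hX hY),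
      h.bracket_congr univ_mem hn hE (h.mul_smoothAt ha hb) (h.eventually_quot_dual_mul hn hx X Y),
      h2, h2, h2, h.dual_mul_right hx, h.dual_mul_right hx, h.dual_mul_left hx,
      h.bracket_euler hn hx hX, h.bracket_euler hn hx hY]
    simp only [AlgebraField.mul, map_sub, map_add, map_smul, LinearMap.add_apply, hA.mul_assoc,
      hA.mul_left_comm (quot A E X x) (E x)] at h1 ⊢
    have h3 : (A x).mul (quot A E X x) (Y x) =
        (A x).mul (E x) ((A x).mul (quot A E X x) (quot A E Y x)) := by
      rw [hA.mul_left_comm, h.mul_quot hx]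
    rw [h3]
    linear_combination (norm := module) h1
  euler_metric x hx X Y hX hY := by
    have hE := h.euler_smooth x trivial
    have ha := h.quot_smoothAt hn hx hX
    have h1 : pairing (A.dual E).metric X Y =ᶠ[𝓝 x] pairing A.metric (quot A E X) Y :=
      mem_of_superset (h.compl_discriminant_mem_nhds hn hx) fun _ hp => h.dual_form hp X Y
    have h2 := h.euler_metric x trivial _ Y ha hY
    have h3 : quot A E (bracket E X) x = quot A E X x + bracket E (quot A E X) x := by
      rw [quot, h.bracket_euler hn hx hX, map_add,
        inverse_mul_apply (h.mem_compl_discriminant_iff.1 hx)]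
      rfl
    rw [lieFun_congr h1, h.dual_form hx, h.dual_form hx, h.dual_form hx]
    simp only [pairing, AlgebraField.metric, h3, map_add, LinearMap.add_apply] at h2 ⊢
    linear_combination h2

end AlgebraField.AxiomsExceptFlatUnity

end DualAxioms

end AlmostDuality

theorem mainTheorem1 {𝕜 : Type*} [RCLike 𝕜] {F : Type*} [NormedAddCommGroup F] [NormedSpace 𝕜 F]
    [FiniteDimensional 𝕜 F] {M : Type*} [TopologicalSpace M] [ChartedSpace F M]
    (n : ℕ∞ω) (hn : ∞ ≤ n) [IsManifold 𝓘(𝕜, F) n M] [IsManifold 𝓘(𝕜, F) 1 M]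
    (A : AlmostDuality.AlgebraField 𝕜 F M) (E : AlmostDuality.VField 𝕜 F M) (d : 𝕜)
    (h : A.IsFrobenius n E d) :
    IsOpen (A.discriminant E)ᶜ ∧
    (∀ x ∈ (A.discriminant E)ᶜ, IsUnit ((A x).mul (E x) : Module.End 𝕜 (TangentSpace 𝓘(𝕜, F) x))) ∧
    ∃ D : AlmostDuality.Conn 𝕜 F M,
      (A.dual E).AxiomsExceptFlatUnity n E 0 (1 - d) (A.discriminant E)ᶜ D := by
  obtain ⟨D, hD, he⟩ := h
  exact ⟨isOpen_iff_mem_nhds.2 fun _ hx => hD.compl_discriminant_mem_nhds hn hx,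
    fun _ hx => hD.mem_compl_discriminant_iff.1 hx, _, hD.dual_axiomsExceptFlatUnity hn he⟩
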